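/- Let $\Theta\subseteq\mathbb{R}$ and let $\{f(\cdot;\theta):\theta\in\Theta\}$ be a family of probability densities with respect to Lebesgue measure on $\mathbb{R}$. Let $\alpha\in(0,1)$, $t>0$ and $S=\{y:|y|>t\}$, with $\int_S f(y;\theta)\,dy>0$ for all $\theta\in\Theta$. Let $F_S(\cdot;\theta)$ be the distribution function of the truncated density $f(y;\theta)\mathbf 1(y\in S)/\int_S f(u;\theta)\,du$, and $F_S^{-1}(p;\theta)=\inf\{y\in\mathbb{R}:F_S(y;\theta)\ge p\}\in[-\infty,\infty]$. For a prior (probability measure) $\pi$ on $\Theta$ put $m(y)=\int f(y;\theta)\,\pi(d\theta)$ and $\Pr(S)=\int\!\int_S f(y;\theta)\,dy\,\pi(d\theta)$, let $M_S$ be the distribution function, extended to $[-\infty,\infty]$, of the density $m_S(y)=m(y)\mathbf 1(y\in S)/\Pr(S)$ of the selected observations under joint selection on $(\theta,y)$, and for $w\in[0,1]$ put $$H(w;\theta)=M_S\big[F_S^{-1}(\alpha w+1-\alpha;\theta)\big]-M_S\big[F_S^{-1}(\alpha w;\theta)\big].$$ Let $y_1,y_2,\dots$ be i.i.d. with density $m(y)=\int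 f(y;\theta)\,\pi(d\theta)$, where $\pi$ is the true prior. Let $\pi^{[0]}$ be a probability measure on $\Theta$ (the initial guess) with $\pi\ll\pi^{[0]}$. For each $n$ the prior is estimated from a subsample of $k_n$ observations, where $k_n\to\infty$ and the subsample consists of the first $k_n$ terms $x_1,\dots,x_{k_n}$ of a fixed sequence $x_i=y_{\sigma(i)}$ with $\sigma$ injective: $\hat\pi_n=\pi^{[k_n]}$, given by the predictive recursion $$\pi^{[i]}(du)=(1-\gamma_i)\,\pi^{[i-1]}(du)+\gamma_i\,\frac{f(x_i;u)\,\pi^{[i-1]}(du)}{\int f(x_i;v)\,\pi^{[i-1]}(dv)} .$$ Let $\hat H_n(w;\theta)$ be $H(w;\theta)$ with $\hat\pi_n$ in place of $\pi$. Assume (the conditions of Tokdar, Martin and Ghosh, 2009): * A1: $\gamma_i\in(0,1)$, $\sum_i\gamma_i=\infty$ and $\sum_i\gamma_i^2<\infty$; * A2: the mixing distribution $F$ (a probability measure on $\Theta$) is identifiable from the mixture $\int f(\cdot;\theta)\,dF(\theta)$; * A3: for each $y$ the map $\theta\mapsto f(y;\theta)$ is bounded and continuous; * A4: for every $\varepsilon>0$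 and compact $K\subset\mathbb{R}$ there is a compact $\Theta_0\subseteq\Theta$ with $\int_K f(y;\theta)\,dy<\varepsilon$ for all $\theta\in\Theta\setminus\Theta_0$; * A5: there is $B<\infty$ with $\int\{f(y;\theta_1)/f(y;\theta_2)\}^2f(y;\theta_3)\,dy<B$ for all $\theta_1,\theta_2,\theta_3\in\Theta$. Fix $\theta\in\Theta$, write $H(w)=H(w;\theta)$ and $\hat H_n(w)=\hat H_n(w;\theta)$, and let $\Omega_0$ and $\hat\Omega_n$ be the sets of minimizers over $[0,1]$ of $H$ and of $\hat H_n$. Then: (i) for every $\varepsilon>0$, $$\Pr\Big(\sup_{\hat w\in\hat\Omega_n}\ \inf_{w\in\Omega_0}|\hat w-w|\ge\varepsilon\Big)\to0\qquad(n\to\infty);$$ (ii) almost surely, whenever $\hat w_n\in\hat\Omega_n$ for all $n$, one has $H(\hat w_n)\to H(w^\star)=\min_{[0,1]}H$ for some $w^\star\in\Omega_0$. -/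

import Mathlib

open MeasureTheory ProbabilityTheory Set Filter Topology
open scoped ENNReal

namespace SaFAB

noncomputable section

/-- `f y θ`, with `θ` in the parameter space `Θ ⊆ ℝ`, is a family of probability densities
(with respect to Lebesgue measure) on the real line. -/
structure IsSamplingModel {Θ : Set ℝ} (f : ℝ → Θ → ℝ) : Prop where
  nonneg : ∀ y θ, 0 ≤ f y θ
  measurable : ∀ θ, Measurable fun y => f y θ
  integral_eq_one : ∀ θ, ∫ y, f y θ = 1

/-- The selection region `S = {y : |y| > t}`. -/
def selectionRegion (t : ℝ) : Set ℝ := {y | t < |y|}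

/-- The sampling density truncated to `S`: `f_S(y; θ) = f(y; θ) 1(y ∈ S) / ∫_S f(u; θ) du`. -/
def truncDensity {Θ : Set ℝ} (f : ℝ → Θ → ℝ) (t : ℝ) (θ : Θ) (y : ℝ) : ℝ :=
  (selectionRegion t).indicator (fun u => f u θ) y / ∫ u in selectionRegion t, f u θ

/-- The truncated sampling distribution function `F_S(y; θ)`. -/
def truncCDF {Θ : Set ℝ} (f : ℝ → Θ → ℝ) (t : ℝ) (θ : Θ) (y : ℝ) : ℝ :=
  ∫ u in Iic y, truncDensity f t θ u

/-- The generalized quantile function `F_S⁻¹(p; θ) = inf {y ∈ ℝ : F_S(y; θ) ≥ p}`, with values in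
`[-∞, ∞]` (the infimum may be `-∞` for `p = 0` and `+∞` for `p = 1`). -/
def truncQuantile {Θ : Set ℝ} (f : ℝ → Θ → ℝ) (t : ℝ) (θ : Θ) (p : ℝ) : EReal :=
  sInf ((fun y : ℝ => (y : EReal)) '' {y : ℝ | p ≤ truncCDF f t θ y})

/-- The marginal density `m(y) = ∫ f(y; θ) π(dθ)` under the prior `π`. -/
def marginal {Θ : Set ℝ} (f : ℝ → Θ → ℝ) (π : Measure Θ) (y : ℝ) : ℝ :=
  ∫ θ, f y θ ∂π

/-- The marginal probability of selection `Pr(S) = ∫ ∫_S f(y; θ) dy π(dθ)`. -/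
def selectionProb {Θ : Set ℝ} (f : ℝ → Θ → ℝ) (t : ℝ) (π : Measure Θ) : ℝ :=
  ∫ θ, (∫ y in selectionRegion t, f y θ) ∂π

/-- The marginal density of the selected observations under joint selection,
`m_S(y) = m(y) 1(y ∈ S) / Pr(S)`. -/
def selMarginal {Θ : Set ℝ} (f : ℝ → Θ → ℝ) (t : ℝ) (π : Measure Θ) (y : ℝ) : ℝ :=
  (selectionRegion t).indicator (marginal f π) y / selectionProb f t π

/-- The distribution function `M_S` of `m_S`, on `[-∞, ∞]` (so `M_S(-∞) = 0`, `M_S(∞) = 1`). -/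
def selMarginalCDF {Θ : Set ℝ} (f : ℝ → Θ → ℝ) (t : ℝ) (π : Measure Θ) (z : EReal) : ℝ :=
  ∫ y in {y : ℝ | (y : EReal) ≤ z}, selMarginal f t π y

/-- The objective `H(w; θ) = M_S[F_S⁻¹(α w + 1 - α; θ)] - M_S[F_S⁻¹(α w; θ)]`, for the prior `π`.
The oracle objective takes the true prior, the surrogate objective the estimated one. -/
def objective {Θ : Set ℝ} (f : ℝ → Θ → ℝ) (t α : ℝ) (π : Measure Θ) (θ : Θ) (w : ℝ) : ℝ :=
  selMarginalCDF f t π (truncQuantile f t θ (α * w + 1 - α)) -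
    selMarginalCDF f t π (truncQuantile f t θ (α * w))

/-- The set of minimizers over `[0, 1]`. -/
def minimizers (h : ℝ → ℝ) : Set ℝ :=
  {w | w ∈ Icc (0 : ℝ) 1 ∧ ∀ v ∈ Icc (0 : ℝ) 1, h w ≤ h v}

/-- One step of predictive recursion with weight `c` and observation `y`:
`(1 - c) π(du) + c f(y; u) π(du) / m(y)`, where `m(y) = ∫ f(y; u) π(du)`. -/
def prStep {Θ : Set ℝ} (f : ℝ → Θ → ℝ) (c y : ℝ) (π : Measure Θ) : Measure Θ :=
  ENNReal.ofReal (1 - c) • π +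
    ENNReal.ofReal c • π.withDensity fun u => ENNReal.ofReal (f y u / marginal f π y)

/-- The predictive recursion estimate of the prior from the first `n` terms of the data sequence
`x`, with initial guess `π₀`; the weight used with the observation `x i` is `γ i`. -/
def predictiveRecursion {Θ : Set ℝ} (f : ℝ → Θ → ℝ) (π₀ : Measure Θ) (γ x : ℕ → ℝ) :
    ℕ → Measure Θ
  | 0 => π₀
  | n + 1 => prStep f (γ n) (x n) (predictiveRecursion f π₀ γ x n)

/-- The conditions on the weights and on the sampling density under which predictive recursion
is considered. -/
structure PRConditions {Θ : Set ℝ} (f : ℝ → Θ → ℝ) (γ : ℕ → ℝ) : Prop where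
  /-- the weights lie in `(0, 1)`, their sum diverges and the sum of their squares converges -/
  weights_mem : ∀ i, γ i ∈ Ioo (0 : ℝ) 1
  weights_sum : ¬ Summable γ
  weights_sq : Summable fun i => γ i ^ 2
  /-- the mixing distribution is identifiable from the mixture -/
  identifiable : ∀ μ ν : Measure Θ, IsProbabilityMeasure μ → IsProbabilityMeasure ν →
    marginal f μ =ᵐ[volume] marginal f ν → μ = ν
  /-- for each `y` the map `θ ↦ f(y; θ)` is bounded and continuous -/
  bounded : ∀ y, ∃ C : ℝ, ∀ θ, f y θ ≤ C
  continuous : ∀ y, Continuous (f y)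
  /-- for each `ε > 0` and each compact `K ⊆ ℝ` there is a compact `Θ₀ ⊆ Θ` with
  `∫_K f(y; θ) dy < ε` for all `θ ∉ Θ₀` -/
  escape : ∀ ε : ℝ, 0 < ε → ∀ K : Set ℝ, IsCompact K →
    ∃ Θ₀ : Set Θ, IsCompact Θ₀ ∧ ∀ θ, θ ∉ Θ₀ → ∫ y in K, f y θ < ε
  /-- `∫ (f(y; θ₁) / f(y; θ₂))² f(y; θ₃) dy < B` for a finite `B` that does not depend on the
  three parameters; the ratio is infinite where only its denominator vanishes -/
  ratio : ∃ B : ℝ, ∀ θ₁ θ₂ θ₃ : Θ,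
    ∫⁻ y, (ENNReal.ofReal (f y θ₁) / ENNReal.ofReal (f y θ₂)) ^ 2 * ENNReal.ofReal (f y θ₃)
      < ENNReal.ofReal B

end

end SaFAB

/-! The objective depends on the prior only through the mixture `m`, so it is enough that the
estimated mixtures converge to `m` in L¹, and for this that the divergence K_n = ∫ log(m / m_n) m
tends to 0 almost surely.

Condition A5 passes from the kernels to arbitrary mixtures by Jensen's inequality
(`RatioBounded.lintegral_marginal_ratio`): ratios of mixtures have second moment at most B under any
third mixture. Hence all mixtures have the same null sets, 0 ≤ K_n ≤ B, and the second-order terms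
of log(1 - γ + γR) are O(γ²).

To first order a step changes K_n by -γ(∫ g² dμ - 1) on average, where μ is the current estimate and
g(u) = ∫ f(x;u) / m_μ(x) m(x) dx has μ-mean 1. This is at most 0 by Cauchy-Schwarz, so K_n is a
bounded supermartingale up to a summable compensator and converges almost surely.

To see that the limit is 0, follow ∫_A log(dπ_n/dπ₀) dπ, where A is a set with π ≤ Mπ₀ on A and
π(Aᶜ) small; without the truncation to A the divergence of π from π₀ might be infinite. As log v ≤
v, this integral never exceeds M. Its expected increment at step i is at least γ_i(E K_i -
π(Aᶜ)(B+1)) - O(γ_i²). So Σ γ_i E K_i ≤ C + δ Σ γ_i for each δ > 0, and Σ γ_i = ∞ forces lim E K_i =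
0.

A Pinsker-type inequality then makes Ĥ_n converge to H uniformly in w. H is continuous although the
quantile function may jump: the jumps skip sets that are null for f_S(·;θ), hence, by A5, null for
`m` on S. The usual argmin argument on the compact interval [0,1] concludes. -/

namespace SaFAB

/-- A nonnegative, jointly measurable family of probability densities, bounded in the parameter,
whose density ratios are square integrable uniformly over the parameters. -/
structure RatioBounded {Θ : Set ℝ} (f : ℝ → Θ → ℝ) (B : ℝ) : Prop where
  nonneg : ∀ y θ, 0 ≤ f y θ
  measurable : Measurable (Function.uncurry f)
  bounded : ∀ y, ∃ C : ℝ, ∀ θ, f y θ ≤ C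
  lintegral_eq_one : ∀ θ, ∫⁻ y, ENNReal.ofReal (f y θ) = 1
  bound_nonneg : 0 ≤ B
  ratio : ∀ θ₁ θ₂ θ₃ : Θ,
    ∫⁻ y, (ENNReal.ofReal (f y θ₁) / ENNReal.ofReal (f y θ₂)) ^ 2 * ENNReal.ofReal (f y θ₃)
      ≤ ENNReal.ofReal B

theorem IsSamplingModel.exists_ratioBounded {Θ : Set ℝ} {f : ℝ → Θ → ℝ}
    (hf : IsSamplingModel f) {γ : ℕ → ℝ} (hPR : PRConditions f γ) :
    ∃ B, RatioBounded f B := by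
  obtain ⟨B, hB⟩ := hPR.ratio
  refine ⟨max B 0, hf.nonneg, ?_, hPR.bounded, fun θ => ?_, le_max_right _ _, fun a b c => ?_⟩
  · have := measurable_uncurry_of_continuous_of_measurable (u := fun (θ : Θ) (y : ℝ) => f y θ)
      (fun y => hPR.continuous y) hf.measurable
    exact this.comp measurable_swap
  · rw [← ofReal_integral_eq_lintegral_ofReal, hf.integral_eq_one, ENNReal.ofReal_one]
    -- A non-integrable density would have Bochner integral 0 instead of 1.
    · by_contra h
      have := hf.integral_eq_one θ
      rw [integral_undef h] at this
      exact zero_ne_one this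
    · exact Eventually.of_forall fun y => hf.nonneg y θ
  · exact (hB a b c).le.trans (ENNReal.ofReal_le_ofReal (le_max_left _ _))

/-! ### Jensen inequalities for the square and the inverse square -/

section Jensen

variable {T : Type*} [MeasurableSpace T] {μ : Measure T} [IsProbabilityMeasure μ]

/-- Integrate the tangent-line bound 2ca ≤ a² + c² at the mean c; finiteness of c allows the final
cancellation. -/
theorem sq_lintegral_le {a : T → ℝ≥0∞} (hc : ∫⁻ u, a u ∂μ ≠ ∞) :
    (∫⁻ u, a u ∂μ) ^ 2 ≤ ∫⁻ u, a u ^ 2 ∂μ := by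
  set c := ∫⁻ u, a u ∂μ with hcdef
  have key : ∀ u, 2 * c * a u ≤ a u ^ 2 + c ^ 2 := by
    intro u
    rcases eq_or_ne (a u) ∞ with h | h
    · simp [h]
    clear hcdef
    clear_value c
    lift c to NNReal using hc
    lift a u to NNReal using h with b
    norm_cast
    have : 2 * (c : ℝ) * b ≤ b ^ 2 + c ^ 2 := by nlinarith [sq_nonneg ((c : ℝ) - b)]
    exact_mod_cast this
  have h2 : 2 * c * c ≤ ∫⁻ u, a u ^ 2 ∂μ + c ^ 2 := by
    calc 2 * c * c = ∫⁻ u, 2 * c * a u ∂μ := by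
          rw [lintegral_const_mul' _ _ (ENNReal.mul_ne_top (by simp) hc)]
      _ ≤ ∫⁻ u, (a u ^ 2 + c ^ 2) ∂μ := lintegral_mono key
      _ = _ := by rw [lintegral_add_right _ measurable_const]; simp
  have h3 : c ^ 2 + c ^ 2 ≤ ∫⁻ u, a u ^ 2 ∂μ + c ^ 2 := by
    rw [← two_mul]; convert h2 using 1; ring
  exact (ENNReal.add_le_add_iff_right (by finiteness)).1 h3

/-- Integrate the tangent-line bound 3c⁻² ≤ b⁻² + 2c⁻³b of the convex function b⁻² at the mean c. If
c = 0, then b vanishes almost everywhere and the right-hand side is infinite. -/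
theorem inv_sq_lintegral_le {b : T → ℝ≥0∞} (hb : AEMeasurable b μ)
    (hc : ∫⁻ u, b u ∂μ ≠ ∞) :
    (∫⁻ u, b u ∂μ)⁻¹ ^ 2 ≤ ∫⁻ u, (b u)⁻¹ ^ 2 ∂μ := by
  set c := ∫⁻ u, b u ∂μ with hcdef
  rcases eq_or_ne c 0 with h0 | h0
  · have : ∀ᵐ u ∂μ, b u = 0 := (lintegral_eq_zero_iff' hb).1 h0
    have h : ∫⁻ u, (b u)⁻¹ ^ 2 ∂μ = ∫⁻ _, ∞ ∂μ := by
      refine lintegral_congr_ae ?_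
      filter_upwards [this] with u hu
      simp [hu]
    rw [h]; simp
  have key : ∀ u, 3 * c⁻¹ ^ 2 ≤ (b u)⁻¹ ^ 2 + 2 * c⁻¹ ^ 3 * b u := by
    intro u
    rcases eq_or_ne (b u) ∞ with h | h
    · have : 2 * c⁻¹ ^ 3 ≠ 0 := by simp [hc]
      simp [h, ENNReal.mul_top this]
    rcases eq_or_ne (b u) 0 with h' | h'
    · simp [h']
    clear hcdef
    clear_value c
    lift c to NNReal using hc
    lift b u to NNReal using h with b
    have hc0 : c ≠ 0 := by exact_mod_cast h0
    have hb0 : b ≠ 0 := by exact_mod_cast h'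
    rw [← ENNReal.coe_inv hc0, ← ENNReal.coe_inv hb0]
    norm_cast
    have hc1 : (0 : ℝ) < c := by positivity
    have hb1 : (0 : ℝ) < b := by positivity
    have : 3 * (c : ℝ)⁻¹ ^ 2 ≤ (b : ℝ)⁻¹ ^ 2 + 2 * (c : ℝ)⁻¹ ^ 3 * b := by
      have e : (b : ℝ)⁻¹ ^ 2 + 2 * (c : ℝ)⁻¹ ^ 3 * b - 3 * (c : ℝ)⁻¹ ^ 2
          = ((b : ℝ) - c) ^ 2 * (2 * b + c) / (b ^ 2 * c ^ 3) := by
        field_simp; ring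
      have : 0 ≤ ((b : ℝ) - c) ^ 2 * (2 * b + c) / (b ^ 2 * c ^ 3) := by positivity
      linarith
    exact_mod_cast this
  have hci : c⁻¹ ≠ ∞ := by simpa using h0
  have h2 : 3 * c⁻¹ ^ 2 ≤ ∫⁻ u, (b u)⁻¹ ^ 2 ∂μ + 2 * c⁻¹ ^ 2 := by
    calc 3 * c⁻¹ ^ 2 = ∫⁻ u, 3 * c⁻¹ ^ 2 ∂μ := by simp
      _ ≤ ∫⁻ u, ((b u)⁻¹ ^ 2 + 2 * c⁻¹ ^ 3 * b u) ∂μ := lintegral_mono key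
      _ = ∫⁻ u, (b u)⁻¹ ^ 2 ∂μ + 2 * c⁻¹ ^ 3 * c := by
          rw [lintegral_add_right' _ (hb.const_mul _), lintegral_const_mul' _ _ (by finiteness)]
      _ = _ := by
          congr 1
          rw [pow_succ, mul_assoc, mul_assoc, ENNReal.inv_mul_cancel h0 hc, mul_one]
  have h3 : c⁻¹ ^ 2 + 2 * c⁻¹ ^ 2 ≤ ∫⁻ u, (b u)⁻¹ ^ 2 ∂μ + 2 * c⁻¹ ^ 2 := by
    convert h2 using 1; ring
  exact (ENNReal.add_le_add_iff_right (by finiteness)).1 h3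

/-- An integral bound that is uniform in a parameter persists under averaging. -/
theorem lintegral_le_of_le_average {Y : Type*} [MeasurableSpace Y] {ν : Measure Y} [SFinite ν]
    {F : Y → ℝ≥0∞} {G : Y → T → ℝ≥0∞} {b : ℝ≥0∞} (hG : Measurable (Function.uncurry G))
    (hFG : ∀ y, F y ≤ ∫⁻ u, G y u ∂μ) (hb : ∀ u, ∫⁻ y, G y u ∂ν ≤ b) :
    ∫⁻ y, F y ∂ν ≤ b :=
  calc ∫⁻ y, F y ∂ν ≤ ∫⁻ y, ∫⁻ u, G y u ∂μ ∂ν := lintegral_mono hFG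
    _ = ∫⁻ u, ∫⁻ y, G y u ∂ν ∂μ := lintegral_lintegral_swap hG.aemeasurable
    _ ≤ ∫⁻ _, b ∂μ := lintegral_mono hb
    _ = b := by simp

end Jensen

/-! ### Mixtures and the ratio bound A5 for them -/

section Mixtures

variable {Θ : Set ℝ} {f : ℝ → Θ → ℝ} {B : ℝ}

theorem RatioBounded.measurable_ofReal (h : RatioBounded f B) :
    Measurable (fun p : ℝ × Θ => ENNReal.ofReal (f p.1 p.2)) :=
  h.measurable.ennreal_ofReal

theorem RatioBounded.integrable (h : RatioBounded f B) (μ : Measure Θ) [IsFiniteMeasure μ]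
    (y : ℝ) : Integrable (f y) μ := by
  obtain ⟨C, hC⟩ := h.bounded y
  refine Integrable.of_bound (h.measurable.of_uncurry_left).aestronglyMeasurable C ?_
  exact Eventually.of_forall fun θ => by
    rw [Real.norm_of_nonneg (h.nonneg y θ)]; exact hC θ

theorem RatioBounded.marginal_eq_toReal (h : RatioBounded f B) (μ : Measure Θ) (y : ℝ) :
    marginal f μ y = (∫⁻ θ, ENNReal.ofReal (f y θ) ∂μ).toReal :=
  integral_eq_lintegral_of_nonneg_ae (Eventually.of_forall (h.nonneg y))
    (h.measurable.of_uncurry_left).aestronglyMeasurable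

theorem RatioBounded.ofReal_marginal (h : RatioBounded f B) (μ : Measure Θ) [IsFiniteMeasure μ]
    (y : ℝ) : ENNReal.ofReal (marginal f μ y) = ∫⁻ θ, ENNReal.ofReal (f y θ) ∂μ :=
  ofReal_integral_eq_lintegral_ofReal (h.integrable μ y) (Eventually.of_forall (h.nonneg y))

theorem RatioBounded.marginal_nonneg (h : RatioBounded f B) (μ : Measure Θ) (y : ℝ) :
    0 ≤ marginal f μ y :=
  integral_nonneg (h.nonneg y)

theorem RatioBounded.measurable_marginal (h : RatioBounded f B) (μ : Measure Θ) [SFinite μ] :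
    Measurable (marginal f μ) := by
  have : marginal f μ = fun y => (∫⁻ θ, ENNReal.ofReal (f y θ) ∂μ).toReal :=
    funext (h.marginal_eq_toReal μ)
  rw [this]
  exact h.measurable_ofReal.lintegral_prod_right'.ennreal_toReal

theorem RatioBounded.lintegral_marginal (h : RatioBounded f B) (μ : Measure Θ)
    [IsFiniteMeasure μ] : ∫⁻ y, ENNReal.ofReal (marginal f μ y) = μ univ := by
  simp_rw [h.ofReal_marginal μ]
  rw [lintegral_lintegral_swap h.measurable_ofReal.aemeasurable]
  simp [h.lintegral_eq_one]

theorem RatioBounded.integrable_marginal (h : RatioBounded f B) (μ : Measure Θ)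
    [IsFiniteMeasure μ] : Integrable (marginal f μ) := by
  refine ⟨(h.measurable_marginal μ).aestronglyMeasurable, ?_⟩
  rw [hasFiniteIntegral_iff_ofReal (Eventually.of_forall (h.marginal_nonneg μ)),
    h.lintegral_marginal]
  exact measure_lt_top _ _

theorem RatioBounded.marginal_dirac (h : RatioBounded f B) (θ : Θ) (y : ℝ) :
    marginal f (Measure.dirac θ) y = f y θ :=
  integral_dirac' _ _ (h.measurable.of_uncurry_left).stronglyMeasurable

/-- The three parameters are averaged out one at a time: the weight θ₃ enters linearly, the
denominator θ₂ through the convex b⁻², the numerator θ₁ through the convex a². -/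
theorem RatioBounded.lintegral_marginal_ratio (h : RatioBounded f B)
    (μ₁ μ₂ μ₃ : Measure Θ) [IsProbabilityMeasure μ₁] [IsProbabilityMeasure μ₂]
    [IsProbabilityMeasure μ₃] :
    ∫⁻ y, (ENNReal.ofReal (marginal f μ₁ y) / ENNReal.ofReal (marginal f μ₂ y)) ^ 2
      * ENNReal.ofReal (marginal f μ₃ y) ≤ ENNReal.ofReal B := by
  have hm := h.measurable_ofReal
  have hmm : ∀ (μ : Measure Θ) [IsProbabilityMeasure μ],
      Measurable fun y => ENNReal.ofReal (marginal f μ y) :=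
    fun μ _ => (h.measurable_marginal μ).ennreal_ofReal
  have hs : ∀ θ, Measurable fun y => ENNReal.ofReal (f y θ) :=
    fun θ => (h.measurable.of_uncurry_right).ennreal_ofReal
  have hsec : ∀ y, Measurable fun θ => ENNReal.ofReal (f y θ) :=
    fun y => (h.measurable.of_uncurry_left).ennreal_ofReal
  have hfin : ∀ (μ : Measure Θ) [IsProbabilityMeasure μ] (y : ℝ),
      ∫⁻ θ, ENNReal.ofReal (f y θ) ∂μ ≠ ∞ := fun μ _ y => by
    rw [← h.ofReal_marginal]; exact ENNReal.ofReal_ne_top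
  have hmm' : ∀ (μ : Measure Θ) [IsProbabilityMeasure μ],
      Measurable fun p : ℝ × Θ => ENNReal.ofReal (marginal f μ p.1) :=
    fun μ _ => (hmm μ).comp measurable_fst
  have hs' : ∀ θ, Measurable fun p : ℝ × Θ => ENNReal.ofReal (f p.1 θ) :=
    fun θ => (hs θ).comp measurable_fst
  have s1 : ∀ θ₁ θ₂, ∫⁻ y, (ENNReal.ofReal (f y θ₁) / ENNReal.ofReal (f y θ₂)) ^ 2
      * ENNReal.ofReal (marginal f μ₃ y) ≤ ENNReal.ofReal B := fun θ₁ θ₂ => by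
    refine lintegral_le_of_le_average (μ := μ₃) (G := fun y θ₃ =>
      (ENNReal.ofReal (f y θ₁) / ENNReal.ofReal (f y θ₂)) ^ 2 * ENNReal.ofReal (f y θ₃))
      ((((hs' θ₁).fun_div (hs' θ₂)).pow_const 2).fun_mul hm) (fun y => ?_) (h.ratio θ₁ θ₂)
    rw [lintegral_const_mul _ (hsec y), h.ofReal_marginal]
  have s2 : ∀ θ₁, ∫⁻ y, (ENNReal.ofReal (f y θ₁) / ENNReal.ofReal (marginal f μ₂ y)) ^ 2
      * ENNReal.ofReal (marginal f μ₃ y) ≤ ENNReal.ofReal B := fun θ₁ => by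
    refine lintegral_le_of_le_average (μ := μ₂) (G := fun y θ₂ =>
      (ENNReal.ofReal (f y θ₁) / ENNReal.ofReal (f y θ₂)) ^ 2
        * ENNReal.ofReal (marginal f μ₃ y))
      ((((hs' θ₁).fun_div hm).pow_const 2).fun_mul (hmm' μ₃)) (fun y => ?_) (s1 θ₁)
    rw [lintegral_mul_const' _ _ ENNReal.ofReal_ne_top]
    gcongr
    simp_rw [div_eq_mul_inv, mul_pow]
    rw [lintegral_const_mul' _ _ (by finiteness), h.ofReal_marginal]
    gcongr
    exact inv_sq_lintegral_le (hsec y).aemeasurable (hfin μ₂ y)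
  refine lintegral_le_of_le_average (μ := μ₁) (G := fun y θ₁ =>
      (ENNReal.ofReal (f y θ₁) / ENNReal.ofReal (marginal f μ₂ y)) ^ 2
        * ENNReal.ofReal (marginal f μ₃ y))
      (((hm.fun_div (hmm' μ₂)).pow_const 2).fun_mul (hmm' μ₃)) (fun y => ?_) s2
  rw [lintegral_mul_const' _ _ ENNReal.ofReal_ne_top]
  gcongr
  simp_rw [div_eq_mul_inv, mul_pow]
  rw [lintegral_mul_const _ ((hsec y).pow_const 2), h.ofReal_marginal]
  gcongr
  exact sq_lintegral_le (hfin μ₁ y)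

end Mixtures

/-! ### The law of the data and the Kullback–Leibler divergence -/

section DataLaw

variable {Θ : Set ℝ} {f : ℝ → Θ → ℝ} {B : ℝ}

/-- The law on the line with density `marginal f π`. -/
noncomputable def dataLaw (f : ℝ → Θ → ℝ) (π : Measure Θ) : Measure ℝ :=
  volume.withDensity fun u => ENNReal.ofReal (marginal f π u)

theorem RatioBounded.isProbabilityMeasure_dataLaw (h : RatioBounded f B) (π : Measure Θ)
    [IsProbabilityMeasure π] : IsProbabilityMeasure (dataLaw f π) :=
  ⟨by rw [dataLaw, withDensity_apply _ MeasurableSet.univ, Measure.restrict_univ,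
      h.lintegral_marginal, measure_univ]⟩

theorem RatioBounded.lintegral_dataLaw (h : RatioBounded f B) (π : Measure Θ) [SFinite π]
    {g : ℝ → ℝ≥0∞} (hg : Measurable g) :
    ∫⁻ y, g y ∂(dataLaw f π) = ∫⁻ y, g y * ENNReal.ofReal (marginal f π y) := by
  rw [dataLaw, lintegral_withDensity_eq_lintegral_mul _ (h.measurable_marginal π).ennreal_ofReal hg]
  simp [mul_comm]

/-- Where only the denominator vanishes the squared ratio is ∞, which a finite integral permits only
on a null set. This makes the convention x / 0 = 0 harmless in all later real-valued ratios. -/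
theorem RatioBounded.ae_pos_imp_pos (h : RatioBounded f B) (μ₁ μ₂ : Measure Θ)
    [IsProbabilityMeasure μ₁] [IsProbabilityMeasure μ₂] :
    ∀ᵐ y, 0 < marginal f μ₁ y → 0 < marginal f μ₂ y := by
  have hlt : ∫⁻ y, (ENNReal.ofReal (marginal f μ₁ y) / ENNReal.ofReal (marginal f μ₂ y)) ^ 2
      * ENNReal.ofReal (marginal f μ₁ y) ≠ ∞ :=
    ne_top_of_le_ne_top ENNReal.ofReal_ne_top (h.lintegral_marginal_ratio μ₁ μ₂ μ₁)
  have m1 := (h.measurable_marginal μ₁).ennreal_ofReal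
  have m2 := (h.measurable_marginal μ₂).ennreal_ofReal
  filter_upwards [ae_lt_top (((m1.fun_div m2).pow_const 2).fun_mul m1) hlt] with y hy hpos
  by_contra hn
  have h0 : ENNReal.ofReal (marginal f μ₂ y) = 0 := ENNReal.ofReal_of_nonpos (not_lt.1 hn)
  have h1 : ENNReal.ofReal (marginal f μ₁ y) ≠ 0 := by simpa using hpos
  rw [h0, ENNReal.div_zero h1] at hy
  simp [ENNReal.top_mul h1] at hy

theorem RatioBounded.ae_marginal_pos (h : RatioBounded f B) (π μ : Measure Θ)
    [IsProbabilityMeasure π] [IsProbabilityMeasure μ] :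
    ∀ᵐ y ∂(dataLaw f π), 0 < marginal f μ y := by
  rw [dataLaw, ae_withDensity_iff (h.measurable_marginal π).ennreal_ofReal]
  filter_upwards [h.ae_pos_imp_pos π μ] with y hy h1
  exact hy (by simpa using h1)

theorem RatioBounded.lintegral_sq_ratio (h : RatioBounded f B) (π μ₁ μ₂ : Measure Θ)
    [IsProbabilityMeasure π] [IsProbabilityMeasure μ₁] [IsProbabilityMeasure μ₂] :
    ∫⁻ y, ENNReal.ofReal ((marginal f μ₁ y / marginal f μ₂ y) ^ 2) ∂(dataLaw f π)
      ≤ ENNReal.ofReal B := by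
  have e : ∫⁻ y, ENNReal.ofReal ((marginal f μ₁ y / marginal f μ₂ y) ^ 2) ∂(dataLaw f π)
      = ∫⁻ y, (ENNReal.ofReal (marginal f μ₁ y) / ENNReal.ofReal (marginal f μ₂ y)) ^ 2
        ∂(dataLaw f π) := by
    refine lintegral_congr_ae ?_
    filter_upwards [h.ae_marginal_pos π μ₂] with y hy
    rw [ENNReal.ofReal_pow (div_nonneg (h.marginal_nonneg _ _) hy.le),
      ENNReal.ofReal_div_of_pos hy]
  rw [e, h.lintegral_dataLaw]
  · exact h.lintegral_marginal_ratio μ₁ μ₂ π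
  · exact ((h.measurable_marginal μ₁).ennreal_ofReal.fun_div
      (h.measurable_marginal μ₂).ennreal_ofReal).pow_const 2

theorem RatioBounded.measurable_ratio (h : RatioBounded f B) (μ₁ μ₂ : Measure Θ)
    [SFinite μ₁] [SFinite μ₂] : Measurable fun y => marginal f μ₁ y / marginal f μ₂ y :=
  (h.measurable_marginal μ₁).fun_div (h.measurable_marginal μ₂)

theorem RatioBounded.ratio_nonneg (h : RatioBounded f B) (μ₁ μ₂ : Measure Θ) (y : ℝ) :
    0 ≤ marginal f μ₁ y / marginal f μ₂ y :=
  div_nonneg (h.marginal_nonneg _ _) (h.marginal_nonneg _ _)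

section

variable (π μ₁ μ₂ : Measure Θ)
    [IsProbabilityMeasure π] [IsProbabilityMeasure μ₁] [IsProbabilityMeasure μ₂]

theorem RatioBounded.integrable_sq_ratio (h : RatioBounded f B) :
    Integrable (fun y => (marginal f μ₁ y / marginal f μ₂ y) ^ 2) (dataLaw f π) := by
  refine ⟨((h.measurable_ratio μ₁ μ₂).pow_const 2).aestronglyMeasurable, ?_⟩
  rw [hasFiniteIntegral_iff_ofReal (Eventually.of_forall fun y => sq_nonneg _)]
  exact (h.lintegral_sq_ratio π μ₁ μ₂).trans_lt ENNReal.ofReal_lt_top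

theorem RatioBounded.integral_sq_ratio_le (h : RatioBounded f B) :
    ∫ y, (marginal f μ₁ y / marginal f μ₂ y) ^ 2 ∂(dataLaw f π) ≤ B := by
  rw [integral_eq_lintegral_of_nonneg_ae (Eventually.of_forall fun y => sq_nonneg _)
    ((h.measurable_ratio μ₁ μ₂).pow_const 2).aestronglyMeasurable]
  exact ENNReal.toReal_le_of_le_ofReal h.bound_nonneg (h.lintegral_sq_ratio π μ₁ μ₂)

theorem RatioBounded.integrable_ratio (h : RatioBounded f B) :
    Integrable (fun y => marginal f μ₁ y / marginal f μ₂ y) (dataLaw f π) := by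
  have := h.isProbabilityMeasure_dataLaw π
  refine Integrable.mono' ((integrable_const 1).add (h.integrable_sq_ratio π μ₁ μ₂))
    (h.measurable_ratio μ₁ μ₂).aestronglyMeasurable (Eventually.of_forall fun y => ?_)
  rw [Real.norm_of_nonneg (h.ratio_nonneg _ _ _)]
  simp only [Pi.add_apply]
  nlinarith [sq_nonneg (marginal f μ₁ y / marginal f μ₂ y - 1), h.ratio_nonneg μ₁ μ₂ y]

theorem RatioBounded.integral_ratio_le (h : RatioBounded f B) :
    ∫ y, marginal f μ₁ y / marginal f μ₂ y ∂(dataLaw f π) ≤ B + 1 := by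
  have := h.isProbabilityMeasure_dataLaw π
  calc ∫ y, marginal f μ₁ y / marginal f μ₂ y ∂(dataLaw f π)
      ≤ ∫ y, ((marginal f μ₁ y / marginal f μ₂ y) ^ 2 + 1) ∂(dataLaw f π) := by
        refine integral_mono (h.integrable_ratio π μ₁ μ₂)
          ((h.integrable_sq_ratio π μ₁ μ₂).add (integrable_const 1)) fun y => ?_
        simp only
        nlinarith [sq_nonneg (marginal f μ₁ y / marginal f μ₂ y - 1), h.ratio_nonneg μ₁ μ₂ y]
    _ ≤ B + 1 := by
        rw [integral_add (h.integrable_sq_ratio π μ₁ μ₂) (integrable_const 1)]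
        have := h.integral_sq_ratio_le π μ₁ μ₂
        simpa using this

end

/-- The Kullback–Leibler divergence of the mixture under `μ` from the mixture under `π`. -/
noncomputable def kl (f : ℝ → Θ → ℝ) (π μ : Measure Θ) : ℝ :=
  ∫ y, Real.log (marginal f π y / marginal f μ y) ∂(dataLaw f π)

section KL

variable (π μ : Measure Θ) [IsProbabilityMeasure π] [IsProbabilityMeasure μ]

theorem RatioBounded.abs_log_ratio_le (h : RatioBounded f B) :
    ∀ᵐ y ∂(dataLaw f π), |Real.log (marginal f π y / marginal f μ y)|
      ≤ marginal f π y / marginal f μ y + marginal f μ y / marginal f π y := by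
  filter_upwards [h.ae_marginal_pos π μ, h.ae_marginal_pos π π] with y h1 h2
  have h3 := Real.log_le_sub_one_of_pos (div_pos h2 h1)
  have h4 := Real.log_le_sub_one_of_pos (div_pos h1 h2)
  have h5 : Real.log (marginal f μ y / marginal f π y)
      = -Real.log (marginal f π y / marginal f μ y) := by rw [← Real.log_inv, inv_div]
  have := div_pos h1 h2
  have := div_pos h2 h1
  rw [abs_le]; constructor <;> linarith

theorem RatioBounded.integrable_log_ratio (h : RatioBounded f B) :
    Integrable (fun y => Real.log (marginal f π y / marginal f μ y)) (dataLaw f π) :=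
  ((h.integrable_ratio π π μ).add (h.integrable_ratio π μ π)).mono'
    (h.measurable_ratio π μ).log.aestronglyMeasurable (h.abs_log_ratio_le π μ)

/-- Equality, and not merely ≤ 1, because the mixture under μ has no mass where the one under π
vanishes. -/
theorem RatioBounded.integral_ratio_eq_one (h : RatioBounded f B) :
    ∫ y, marginal f μ y / marginal f π y ∂(dataLaw f π) = 1 := by
  rw [integral_eq_lintegral_of_nonneg_ae (Eventually.of_forall (h.ratio_nonneg μ π))
    (h.measurable_ratio μ π).aestronglyMeasurable,
    h.lintegral_dataLaw _ (h.measurable_ratio μ π).ennreal_ofReal]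
  have : ∫⁻ y, ENNReal.ofReal (marginal f μ y / marginal f π y) * ENNReal.ofReal (marginal f π y)
      = ∫⁻ y, ENNReal.ofReal (marginal f μ y) := by
    refine lintegral_congr_ae ?_
    filter_upwards [h.ae_pos_imp_pos μ π] with y hy
    rw [← ENNReal.ofReal_mul (h.ratio_nonneg _ _ _)]
    rcases (h.marginal_nonneg μ y).eq_or_lt with h0 | h0
    · simp [← h0]
    · rw [div_mul_cancel₀ _ (hy h0).ne']
  rw [this, h.lintegral_marginal]
  simp

theorem RatioBounded.kl_le_integral_ratio_sub_one (h : RatioBounded f B) :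
    kl f π μ ≤ ∫ y, marginal f π y / marginal f μ y ∂(dataLaw f π) - 1 := by
  have := h.isProbabilityMeasure_dataLaw π
  have : kl f π μ ≤ ∫ y, (marginal f π y / marginal f μ y - 1) ∂(dataLaw f π) := by
    refine integral_mono_ae (h.integrable_log_ratio π μ)
      ((h.integrable_ratio π π μ).sub (integrable_const 1)) ?_
    filter_upwards [h.ae_marginal_pos π μ, h.ae_marginal_pos π π] with y h1 h2
    exact Real.log_le_sub_one_of_pos (div_pos h2 h1)
  rw [integral_sub (h.integrable_ratio π π μ) (integrable_const 1)] at this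
  simpa using this

theorem RatioBounded.kl_le (h : RatioBounded f B) : kl f π μ ≤ B := by
  have := h.kl_le_integral_ratio_sub_one π μ
  have := h.integral_ratio_le π π μ
  linarith

theorem RatioBounded.kl_nonneg (h : RatioBounded f B) : 0 ≤ kl f π μ := by
  have := h.isProbabilityMeasure_dataLaw π
  have : ∫ y, (1 - marginal f μ y / marginal f π y) ∂(dataLaw f π) ≤ kl f π μ := by
    refine integral_mono_ae ((integrable_const 1).sub (h.integrable_ratio π μ π))
      (h.integrable_log_ratio π μ) ?_
    filter_upwards [h.ae_marginal_pos π μ, h.ae_marginal_pos π π] with y h1 h2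
    have := Real.one_sub_inv_le_log_of_pos (div_pos h2 h1)
    rwa [inv_div] at this
  rw [integral_sub (integrable_const 1) (h.integrable_ratio π μ π),
    h.integral_ratio_eq_one π μ] at this
  simpa using this

/-- A Pinsker-type inequality. -/
theorem RatioBounded.integral_abs_marginal_sub_le (h : RatioBounded f B) {δ : ℝ} (hδ : 0 < δ) :
    ∫ y, |marginal f μ y - marginal f π y| ≤ kl f π μ / (2 * δ) + 2 * δ := by
  have := h.isProbabilityMeasure_dataLaw π
  have e : ∫ y, |marginal f μ y - marginal f π y|
      = ∫ y, |marginal f μ y / marginal f π y - 1| ∂(dataLaw f π) := by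
    rw [dataLaw, integral_withDensity_eq_integral_toReal_smul
      (h.measurable_marginal π).ennreal_ofReal (by simp)]
    refine integral_congr_ae ?_
    filter_upwards [h.ae_pos_imp_pos μ π] with y hy
    rw [ENNReal.toReal_ofReal (h.marginal_nonneg _ _), smul_eq_mul]
    rcases (h.marginal_nonneg π y).eq_or_lt with h0 | h0
    · have : marginal f μ y = 0 := by
        by_contra hne
        exact (hy (lt_of_le_of_ne (h.marginal_nonneg _ _) (Ne.symm hne))).ne h0
      rw [← h0, this]; simp
    · conv_rhs => rw [← abs_of_pos h0, ← abs_mul, abs_of_pos h0]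
      congr 1; field_simp
  have i1 := h.integrable_log_ratio π μ
  have i2 := h.integrable_ratio π μ π
  have i3 : Integrable (fun y => marginal f μ y / marginal f π y - 1) (dataLaw f π) :=
    i2.sub (integrable_const 1)
  have i4 : Integrable (fun y => marginal f μ y / marginal f π y + 1) (dataLaw f π) :=
    i2.add (integrable_const 1)
  have i5 : Integrable (fun y => (Real.log (marginal f π y / marginal f μ y)
      + (marginal f μ y / marginal f π y - 1)) / (2 * δ)) (dataLaw f π) :=
    (i1.add i3).div_const (2 * δ)
  have key : ∫ y, |marginal f μ y / marginal f π y - 1| ∂(dataLaw f π)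
      ≤ ∫ y, ((Real.log (marginal f π y / marginal f μ y) + (marginal f μ y / marginal f π y - 1))
        / (2 * δ) + (marginal f μ y / marginal f π y + 1) * δ) ∂(dataLaw f π) := by
    refine integral_mono_ae i3.abs (i5.add (i4.mul_const δ)) ?_
    filter_upwards [h.ae_marginal_pos π μ, h.ae_marginal_pos π π] with y h1 h2
    set r := marginal f μ y / marginal f π y with hr
    have hr0 : 0 < r := div_pos h1 h2
    have e1 : marginal f π y / marginal f μ y = r⁻¹ := by rw [hr, inv_div]
    rw [e1, Real.log_inv]
    -- With q = √r, log q ≤ q - 1 gives (q - 1)² ≤ -log r + r - 1. Young's inequality with weight δ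
    -- and (q + 1)² ≤ 2(q² + 1) then bound |r - 1| = |q - 1|(q + 1). On integrating, r - 1 has mean
    -- 0 and r + 1 has mean 2.
    set q := Real.sqrt r with hq
    have hq0 : 0 < q := Real.sqrt_pos.2 hr0
    have hqr : r = q ^ 2 := (Real.sq_sqrt hr0.le).symm
    have hl : Real.log r ≤ 2 * (q - 1) := by
      have := Real.log_le_sub_one_of_pos hq0
      rw [hqr, Real.log_pow]; push_cast; linarith
    have h3 : (q - 1) ^ 2 ≤ -Real.log r + (r - 1) := by nlinarith
    have h4 : |r - 1| = |q - 1| * (q + 1) := by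
      rw [show r - 1 = (q - 1) * (q + 1) by rw [hqr]; ring, abs_mul,
        abs_of_pos (show 0 < q + 1 by linarith)]
    have h5 : |q - 1| * (q + 1) ≤ (q - 1) ^ 2 / (2 * δ) + (q ^ 2 + 1) * δ := by
      rw [div_add' _ _ _ (by positivity), le_div_iff₀ (by positivity), ← sq_abs (q - 1)]
      nlinarith [sq_nonneg (|q - 1| - δ * (q + 1)), mul_nonneg (sq_nonneg δ) (sq_nonneg (q - 1))]
    change |r - 1| ≤ _
    rw [h4]
    refine h5.trans ?_
    rw [← hqr]
    gcongr
  rw [e]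
  refine key.trans (le_of_eq ?_)
  rw [integral_add i5 (i4.mul_const δ), integral_div, integral_mul_const, integral_add i1 i3,
    integral_sub i2 (integrable_const 1), integral_add i2 (integrable_const 1),
    h.integral_ratio_eq_one π μ]
  simp [kl]
  norm_num

end KL

/-- Apply log z ≥ 1 - 1/z at z = 1 + c(R - 1), then z ≥ 1 - c and (R - 1)² ≤ R² + 1. The remainder
involves only R², whose mean A5 controls. -/
theorem sub_le_log_one_sub_add_mul {c R : ℝ} (hc : c ∈ Ioo (0 : ℝ) 1) (hR : 0 ≤ R) :
    c * (R - 1) - c ^ 2 / (1 - c) * (R ^ 2 + 1) ≤ Real.log (1 - c + c * R) := by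
  obtain ⟨h0, h1⟩ := hc
  have hp : 0 < 1 - c := by linarith
  have hcR : 0 ≤ c * R := by positivity
  have hz : 0 < 1 - c + c * R := by linarith
  refine le_trans ?_ (Real.one_sub_inv_le_log_of_pos hz)
  have e : 1 - (1 - c + c * R)⁻¹ = c * (R - 1) - (c * (R - 1)) ^ 2 / (1 - c + c * R) := by
    field_simp; ring
  rw [e]
  have : (c * (R - 1)) ^ 2 / (1 - c + c * R) ≤ c ^ 2 / (1 - c) * (R ^ 2 + 1) := by
    calc (c * (R - 1)) ^ 2 / (1 - c + c * R) ≤ (c * (R - 1)) ^ 2 / (1 - c) := by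
          gcongr; linarith
      _ = c ^ 2 / (1 - c) * (R - 1) ^ 2 := by ring
      _ ≤ _ := by gcongr; nlinarith
  linarith

end DataLaw

/-! ### One step of predictive recursion -/

section Posterior

variable {Θ : Set ℝ} {f : ℝ → Θ → ℝ} {B : ℝ}

/-- The posterior on the parameter space given the observation `x`, under the prior `μ`. -/
noncomputable def posterior (f : ℝ → Θ → ℝ) (x : ℝ) (μ : Measure Θ) : Measure Θ :=
  μ.withDensity fun u => ENNReal.ofReal (f x u / marginal f μ x)

theorem prStep_eq (c x : ℝ) (μ : Measure Θ) :
    prStep f c x μ = ENNReal.ofReal (1 - c) • μ + ENNReal.ofReal c • posterior f x μ := rfl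

theorem RatioBounded.lintegral_ratio_marginal (h : RatioBounded f B) (μ : Measure Θ)
    [IsFiniteMeasure μ] {x : ℝ} (hx : 0 < marginal f μ x) :
    ∫⁻ u, ENNReal.ofReal (f x u / marginal f μ x) ∂μ = 1 := by
  simp_rw [ENNReal.ofReal_div_of_pos hx, div_eq_mul_inv]
  rw [lintegral_mul_const _ (h.measurable.of_uncurry_left).ennreal_ofReal, ← h.ofReal_marginal,
    ENNReal.mul_inv_cancel (by simpa using hx) ENNReal.ofReal_ne_top]

theorem RatioBounded.isProbabilityMeasure_posterior (h : RatioBounded f B) (μ : Measure Θ)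
    [IsFiniteMeasure μ] {x : ℝ} (hx : 0 < marginal f μ x) :
    IsProbabilityMeasure (posterior f x μ) :=
  ⟨by rw [posterior, withDensity_apply _ MeasurableSet.univ, Measure.restrict_univ,
    h.lintegral_ratio_marginal μ hx]⟩

theorem RatioBounded.isProbabilityMeasure_prStep (h : RatioBounded f B) (μ : Measure Θ)
    [IsProbabilityMeasure μ] {c x : ℝ} (hc : c ∈ Ioo (0 : ℝ) 1) (hx : 0 < marginal f μ x) :
    IsProbabilityMeasure (prStep f c x μ) := by
  have := h.isProbabilityMeasure_posterior μ hx
  refine ⟨?_⟩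
  rw [prStep_eq]
  simp only [Measure.coe_add, Measure.coe_smul, Pi.add_apply, Pi.smul_apply, measure_univ,
    smul_eq_mul, mul_one]
  rw [← ENNReal.ofReal_add (by linarith [hc.2]) hc.1.le]
  simp

theorem RatioBounded.marginal_prStep (h : RatioBounded f B) (μ : Measure Θ)
    [IsProbabilityMeasure μ] {c x : ℝ} (hc : c ∈ Ioo (0 : ℝ) 1) (hx : 0 < marginal f μ x) (y : ℝ) :
    marginal f (prStep f c x μ) y
      = (1 - c) * marginal f μ y + c * marginal f (posterior f x μ) y := by
  have := h.isProbabilityMeasure_posterior μ hx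
  rw [prStep_eq, marginal, integral_add_measure, integral_smul_measure, integral_smul_measure,
    ENNReal.toReal_ofReal (by linarith [hc.2]), ENNReal.toReal_ofReal hc.1.le]
  · rfl
  · exact (h.integrable μ y).smul_measure ENNReal.ofReal_ne_top
  · exact (h.integrable _ y).smul_measure ENNReal.ofReal_ne_top

theorem RatioBounded.measurable_posterior_density (h : RatioBounded f B) (μ : Measure Θ)
    [SFinite μ] : Measurable fun p : ℝ × Θ => ENNReal.ofReal (f p.1 p.2 / marginal f μ p.1) :=
  (h.measurable.fun_div ((h.measurable_marginal μ).comp measurable_fst)).ennreal_ofReal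

theorem RatioBounded.lintegral_posterior (h : RatioBounded f B) (μ : Measure Θ)
    [SFinite μ] (x : ℝ) {g : Θ → ℝ≥0∞} (hg : Measurable g) :
    ∫⁻ u, g u ∂(posterior f x μ) = ∫⁻ u, g u * ENNReal.ofReal (f x u / marginal f μ x) ∂μ := by
  rw [posterior, lintegral_withDensity_eq_lintegral_mul _ _ hg]
  · simp [mul_comm]
  · exact (h.measurable_posterior_density μ).comp measurable_prodMk_left

theorem RatioBounded.measurable_marginal_posterior (h : RatioBounded f B) (μ : Measure Θ)
    [SFinite μ] : Measurable fun p : ℝ × ℝ => marginal f (posterior f p.1 μ) p.2 := by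
  have e : (fun p : ℝ × ℝ => marginal f (posterior f p.1 μ) p.2) = fun p : ℝ × ℝ =>
      (∫⁻ u, ENNReal.ofReal (f p.2 u) * ENNReal.ofReal (f p.1 u / marginal f μ p.1) ∂μ).toReal := by
    ext p
    rw [h.marginal_eq_toReal, h.lintegral_posterior μ _ (h.measurable.of_uncurry_left).ennreal_ofReal]
  rw [e]
  refine (Measurable.lintegral_prod_right' (f := fun q : (ℝ × ℝ) × Θ =>
    ENNReal.ofReal (f q.1.2 q.2) * ENNReal.ofReal (f q.1.1 q.2 / marginal f μ q.1.1))
    ?_).ennreal_toReal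
  exact (h.measurable_ofReal.comp (measurable_fst.snd.prodMk measurable_snd)).mul
    ((h.measurable_posterior_density μ).comp (measurable_fst.fst.prodMk measurable_snd))

variable (π μ : Measure Θ) [IsProbabilityMeasure π] [IsProbabilityMeasure μ]

/-- By Tonelli the double integral is ∫ g² dμ, where g(u) is the mean of f(x;u) / m_μ(x) under the
data law. Since ∫ g dμ = 1, Cauchy-Schwarz applies. This is why the divergence does not grow to
first order. -/
theorem RatioBounded.one_le_lintegral_posterior_ratio (h : RatioBounded f B) :
    1 ≤ ∫⁻ x, ∫⁻ y, ENNReal.ofReal (marginal f (posterior f x μ) y / marginal f μ y)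
      ∂(dataLaw f π) ∂(dataLaw f π) := by
  have := h.isProbabilityMeasure_dataLaw π
  set ν := dataLaw f π
  set s : ℝ → Θ → ℝ≥0∞ := fun x u => ENNReal.ofReal (f x u / marginal f μ x) with hs
  have sm : Measurable (Function.uncurry s) := h.measurable_posterior_density μ
  have sm1 : ∀ x, Measurable (s x) := fun x => sm.of_uncurry_left
  have sm2 : ∀ u, Measurable fun x => s x u := fun u => sm.of_uncurry_right
  have e : ∫⁻ x, ∫⁻ y, ENNReal.ofReal (marginal f (posterior f x μ) y / marginal f μ y) ∂ν ∂ν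
      = ∫⁻ x, ∫⁻ y, ∫⁻ u, s y u * s x u ∂μ ∂ν ∂ν := by
    refine lintegral_congr_ae ?_
    filter_upwards [h.ae_marginal_pos π μ] with x hx
    refine lintegral_congr_ae ?_
    filter_upwards [h.ae_marginal_pos π μ] with y hy
    have := h.isProbabilityMeasure_posterior μ hx
    rw [ENNReal.ofReal_div_of_pos hy, h.ofReal_marginal,
      h.lintegral_posterior μ x (h.measurable.of_uncurry_left).ennreal_ofReal, div_eq_mul_inv,
      ← lintegral_mul_const' _ _ (by simpa using hy)]
    refine lintegral_congr fun u => ?_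
    simp only [hs]
    rw [ENNReal.ofReal_div_of_pos hy, ENNReal.div_eq_inv_mul]
    ring
  set g : Θ → ℝ≥0∞ := fun u => ∫⁻ y, s y u ∂ν with hg
  have gm : Measurable g := sm.lintegral_prod_left
  have e2 : ∫⁻ x, ∫⁻ y, ∫⁻ u, s y u * s x u ∂μ ∂ν ∂ν = ∫⁻ u, g u ^ 2 ∂μ := by
    have : ∀ x, ∫⁻ y, ∫⁻ u, s y u * s x u ∂μ ∂ν = ∫⁻ u, g u * s x u ∂μ := fun x => by
      rw [lintegral_lintegral_swap]
      · refine lintegral_congr fun u => ?_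
        rw [lintegral_mul_const _ (sm2 u)]
      · exact (sm.mul ((sm1 x).comp measurable_snd)).aemeasurable
    simp_rw [this]
    rw [lintegral_lintegral_swap]
    · refine lintegral_congr fun u => ?_
      rw [lintegral_const_mul _ (sm2 u), sq]
    · exact ((gm.comp measurable_snd).mul sm).aemeasurable
  have e3 : ∫⁻ u, g u ∂μ = 1 := by
    rw [hg, ← lintegral_lintegral_swap sm.aemeasurable]
    have : ∫⁻ x, ∫⁻ u, s x u ∂μ ∂ν = ∫⁻ _, 1 ∂ν := by
      refine lintegral_congr_ae ?_
      filter_upwards [h.ae_marginal_pos π μ] with x hx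
      exact h.lintegral_ratio_marginal μ hx
    rw [this]; simp
  rw [e, e2]
  have := sq_lintegral_le (μ := μ) (a := g) (by rw [e3]; simp)
  rwa [e3, one_pow] at this

theorem RatioBounded.integrable_kl_prStep (h : RatioBounded f B) {c : ℝ}
    (hc : c ∈ Ioo (0 : ℝ) 1) :
    Integrable (fun x => kl f π (prStep f c x μ)) (dataLaw f π) := by
  have := h.isProbabilityMeasure_dataLaw π
  have hm : Measurable fun p : ℝ × ℝ => Real.log (marginal f π p.2 /
      ((1 - c) * marginal f μ p.2 + c * marginal f (posterior f p.1 μ) p.2)) :=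
    (((h.measurable_marginal π).comp measurable_snd).fun_div
      ((((h.measurable_marginal μ).comp measurable_snd).const_mul (1 - c)).add
        ((h.measurable_marginal_posterior μ).const_mul c))).log
  have hme := hm.stronglyMeasurable.integral_prod_right' (ν := dataLaw f π)
  have hsm : AEStronglyMeasurable (fun x => kl f π (prStep f c x μ)) (dataLaw f π) := by
    refine hme.aestronglyMeasurable.congr ?_
    filter_upwards [h.ae_marginal_pos π μ] with x hx
    simp only [kl, h.marginal_prStep μ hc hx]
  refine Integrable.of_bound hsm B ?_
  filter_upwards [h.ae_marginal_pos π μ] with x hx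
  have := h.isProbabilityMeasure_prStep μ hc hx
  rw [Real.norm_of_nonneg (h.kl_nonneg _ _)]
  exact h.kl_le _ _

/-- The new mixture is the old one times 1 - c + cR, with R the ratio of the posterior mixture to
the old mixture; the lower bound for log(1 - c + cR) is integrated, and R² has mean at most B. -/
theorem RatioBounded.kl_prStep_le (h : RatioBounded f B) {c x : ℝ}
    (hc : c ∈ Ioo (0 : ℝ) 1) (hx : 0 < marginal f μ x) :
    kl f π (prStep f c x μ) ≤ kl f π μ
      - c * (∫ y, marginal f (posterior f x μ) y / marginal f μ y ∂(dataLaw f π) - 1)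
      + c ^ 2 / (1 - c) * (B + 1) := by
  have := h.isProbabilityMeasure_dataLaw π
  have hp := h.isProbabilityMeasure_posterior μ hx
  have hq := h.isProbabilityMeasure_prStep μ hc hx
  set ν := dataLaw f π
  set K := c ^ 2 / (1 - c) with hK
  have hK0 : 0 ≤ K := div_nonneg (sq_nonneg c) (by linarith [hc.2])
  have i1 := h.integrable_log_ratio π μ
  have i2 := h.integrable_log_ratio π (prStep f c x μ)
  have i3 := h.integrable_ratio π (posterior f x μ) μ
  have i4 := h.integrable_sq_ratio π (posterior f x μ) μ
  have i5 : Integrable (fun y => marginal f (posterior f x μ) y / marginal f μ y - 1) ν :=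
    i3.sub (integrable_const 1)
  have i6 : Integrable (fun y => (marginal f (posterior f x μ) y / marginal f μ y) ^ 2 + 1) ν :=
    i4.add (integrable_const 1)
  have key : ∫ y, (c * (marginal f (posterior f x μ) y / marginal f μ y - 1)
      - K * ((marginal f (posterior f x μ) y / marginal f μ y) ^ 2 + 1)) ∂ν
      ≤ ∫ y, (Real.log (marginal f π y / marginal f μ y)
        - Real.log (marginal f π y / marginal f (prStep f c x μ) y)) ∂ν := by
    refine integral_mono_ae ((i5.const_mul c).sub (i6.const_mul K)) (i1.sub i2) ?_
    filter_upwards [h.ae_marginal_pos π μ, h.ae_marginal_pos π π,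
      h.ae_marginal_pos π (prStep f c x μ)] with y h1 h2 h3
    refine (sub_le_log_one_sub_add_mul hc (h.ratio_nonneg _ _ _)).trans (le_of_eq ?_)
    rw [← Real.log_div (div_pos h2 h1).ne' (div_pos h2 h3).ne']
    congr 1
    rw [h.marginal_prStep μ hc hx] at h3 ⊢
    field_simp
  rw [integral_sub (i5.const_mul c) (i6.const_mul K), integral_const_mul, integral_const_mul,
    integral_sub i1 i2, integral_sub i3 (integrable_const 1),
    integral_add i4 (integrable_const 1)] at key
  simp only [integral_const, probReal_univ, smul_eq_mul, mul_one] at key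
  have hb := mul_le_mul_of_nonneg_left (h.integral_sq_ratio_le π (posterior f x μ) μ) hK0
  simp only [kl]
  nlinarith

/-- One step of predictive recursion increases the expected divergence from the true mixture by
at most a multiple of the squared weight. -/
theorem RatioBounded.integral_kl_prStep_le (h : RatioBounded f B) {c : ℝ}
    (hc : c ∈ Ioo (0 : ℝ) 1) :
    ∫ x, kl f π (prStep f c x μ) ∂(dataLaw f π) ≤ kl f π μ + c ^ 2 / (1 - c) * (B + 1) := by
  have := h.isProbabilityMeasure_dataLaw π
  set ν := dataLaw f π with hν
  set I : ℝ → ℝ := fun x => ∫ y, marginal f (posterior f x μ) y / marginal f μ y ∂ν with hI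
  have hm : Measurable fun p : ℝ × ℝ => marginal f (posterior f p.1 μ) p.2 / marginal f μ p.2 :=
    (h.measurable_marginal_posterior μ).fun_div ((h.measurable_marginal μ).comp measurable_snd)
  have hIm : AEStronglyMeasurable I ν :=
    (hm.stronglyMeasurable.integral_prod_right' (ν := ν)).aestronglyMeasurable
  have hI0 : ∀ x, 0 ≤ I x := fun x => integral_nonneg (h.ratio_nonneg _ _)
  have hIint : Integrable I ν := by
    refine Integrable.of_bound hIm (B + 1) ?_
    filter_upwards [h.ae_marginal_pos π μ] with x hx
    have := h.isProbabilityMeasure_posterior μ hx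
    rw [Real.norm_of_nonneg (hI0 x)]
    exact h.integral_ratio_le π _ μ
  have h1 : 1 ≤ ∫ x, I x ∂ν := by
    have := h.one_le_lintegral_posterior_ratio π μ
    have e : ∫⁻ x, ∫⁻ y, ENNReal.ofReal (marginal f (posterior f x μ) y / marginal f μ y) ∂ν ∂ν
        = ∫⁻ x, ENNReal.ofReal (I x) ∂ν := by
      refine lintegral_congr_ae ?_
      filter_upwards [h.ae_marginal_pos π μ] with x hx
      have := h.isProbabilityMeasure_posterior μ hx
      rw [hI, ofReal_integral_eq_lintegral_ofReal (h.integrable_ratio π _ μ)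
        (Eventually.of_forall (h.ratio_nonneg _ _))]
    rw [e, ← ofReal_integral_eq_lintegral_ofReal hIint (Eventually.of_forall hI0)] at this
    simpa using this
  have key : ∫ x, kl f π (prStep f c x μ) ∂ν
      ≤ ∫ x, (kl f π μ + c + c ^ 2 / (1 - c) * (B + 1) - c * I x) ∂ν := by
    refine integral_mono_ae (h.integrable_kl_prStep π μ hc)
      ((integrable_const _).sub (hIint.const_mul c)) ?_
    filter_upwards [h.ae_marginal_pos π μ] with x hx
    have := h.kl_prStep_le π μ hc hx
    simp only [hI]
    linarith
  rw [integral_sub (integrable_const _) (hIint.const_mul c), integral_const_mul] at key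
  simp only [integral_const, probReal_univ, smul_eq_mul, one_mul] at key
  nlinarith [hc.1]

end Posterior

/-! ### Expected log-density gain under a part of the true prior -/

section PartialPrior

variable {Θ : Set ℝ} {f : ℝ → Θ → ℝ} {B : ℝ}

theorem RatioBounded.likelihood_ratio_nonneg (h : RatioBounded f B) (μ : Measure Θ) (x : ℝ)
    (u : Θ) : 0 ≤ f x u / marginal f μ x :=
  div_nonneg (h.nonneg _ _) (h.marginal_nonneg _ _)

theorem RatioBounded.abs_log_step_le (h : RatioBounded f B) (μ : Measure Θ) {c : ℝ}
    (hc : c ∈ Ioo (0 : ℝ) 1) (x : ℝ) (u : Θ) :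
    |Real.log (1 - c + c * (f x u / marginal f μ x))|
      ≤ f x u / marginal f μ x + |Real.log (1 - c)| := by
  have hc1 : 0 < 1 - c := by linarith [hc.2]
  have h0 := h.likelihood_ratio_nonneg μ x u
  have h1 : 0 ≤ c * (f x u / marginal f μ x) := mul_nonneg hc.1.le h0
  rw [abs_le]
  constructor
  · have := Real.log_le_log hc1 (by linarith : 1 - c ≤ 1 - c + c * (f x u / marginal f μ x))
    have := neg_abs_le (Real.log (1 - c))
    linarith
  · have := Real.log_le_sub_one_of_pos (by linarith : 0 < 1 - c + c * (f x u / marginal f μ x))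
    have := abs_nonneg (Real.log (1 - c))
    have : c * (f x u / marginal f μ x) ≤ 1 * (f x u / marginal f μ x) :=
      mul_le_mul_of_nonneg_right hc.2.le h0
    linarith [hc.1]

variable (π μ : Measure Θ) [IsProbabilityMeasure π] [IsProbabilityMeasure μ]

theorem RatioBounded.measurable_likelihood_ratio (h : RatioBounded f B) :
    Measurable fun p : ℝ × Θ => f p.1 p.2 / marginal f μ p.1 :=
  h.measurable.fun_div ((h.measurable_marginal μ).comp measurable_fst)

/-- A kernel f(·;u) is the mixture under the Dirac mass at u, so the mixture bound holds for each u
and is integrated over ρ. -/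
theorem RatioBounded.lintegral_sq_likelihood_ratio (h : RatioBounded f B) (ρ : Measure Θ)
    [IsFiniteMeasure ρ] :
    ∫⁻ p, ENNReal.ofReal ((f p.1 p.2 / marginal f μ p.1) ^ 2) ∂((dataLaw f π).prod ρ)
      ≤ ENNReal.ofReal B * ρ univ := by
  have := h.isProbabilityMeasure_dataLaw π
  rw [lintegral_prod_symm' _ ((h.measurable_likelihood_ratio μ).pow_const 2).ennreal_ofReal,
    ← lintegral_const]
  refine lintegral_mono fun u => ?_
  have := h.lintegral_sq_ratio π (Measure.dirac u) μ
  simpa only [h.marginal_dirac] using this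

theorem RatioBounded.integrable_sq_likelihood_ratio (h : RatioBounded f B) (ρ : Measure Θ)
    [IsFiniteMeasure ρ] :
    Integrable (fun p : ℝ × Θ => (f p.1 p.2 / marginal f μ p.1) ^ 2) ((dataLaw f π).prod ρ) := by
  refine ⟨((h.measurable_likelihood_ratio μ).pow_const 2).aestronglyMeasurable, ?_⟩
  rw [hasFiniteIntegral_iff_ofReal (Eventually.of_forall fun y => sq_nonneg _)]
  exact (h.lintegral_sq_likelihood_ratio π μ ρ).trans_lt
    (ENNReal.mul_lt_top ENNReal.ofReal_lt_top (measure_lt_top _ _))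

theorem RatioBounded.integral_sq_likelihood_ratio_le (h : RatioBounded f B) (ρ : Measure Θ)
    [IsFiniteMeasure ρ] :
    ∫ p, (f p.1 p.2 / marginal f μ p.1) ^ 2 ∂((dataLaw f π).prod ρ) ≤ B * ρ.real univ := by
  rw [integral_eq_lintegral_of_nonneg_ae (Eventually.of_forall fun y => sq_nonneg _)
    ((h.measurable_likelihood_ratio μ).pow_const 2).aestronglyMeasurable]
  refine ENNReal.toReal_le_of_le_ofReal (mul_nonneg h.bound_nonneg measureReal_nonneg) ?_
  rw [ENNReal.ofReal_mul h.bound_nonneg, measureReal_def, ENNReal.ofReal_toReal (by finiteness)]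
  exact h.lintegral_sq_likelihood_ratio π μ ρ

theorem RatioBounded.integrable_likelihood_ratio (h : RatioBounded f B) (ρ : Measure Θ)
    [IsFiniteMeasure ρ] :
    Integrable (fun p : ℝ × Θ => f p.1 p.2 / marginal f μ p.1) ((dataLaw f π).prod ρ) := by
  have := h.isProbabilityMeasure_dataLaw π
  refine Integrable.mono' ((integrable_const 1).add (h.integrable_sq_likelihood_ratio π μ ρ))
    (h.measurable_likelihood_ratio μ).aestronglyMeasurable (Eventually.of_forall fun p => ?_)
  rw [Real.norm_of_nonneg (h.likelihood_ratio_nonneg _ _ _)]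
  simp only [Pi.add_apply]
  nlinarith [sq_nonneg (f p.1 p.2 / marginal f μ p.1 - 1),
    h.likelihood_ratio_nonneg μ p.1 p.2]

theorem RatioBounded.integral_likelihood_ratio_le (h : RatioBounded f B) (ρ : Measure Θ)
    [IsFiniteMeasure ρ] :
    ∫ p, f p.1 p.2 / marginal f μ p.1 ∂((dataLaw f π).prod ρ) ≤ (B + 1) * ρ.real univ := by
  have := h.isProbabilityMeasure_dataLaw π
  have i2 := h.integrable_sq_likelihood_ratio π μ ρ
  calc ∫ p, f p.1 p.2 / marginal f μ p.1 ∂((dataLaw f π).prod ρ)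
      ≤ ∫ p, ((f p.1 p.2 / marginal f μ p.1) ^ 2 + 1) ∂((dataLaw f π).prod ρ) := by
        refine integral_mono (h.integrable_likelihood_ratio π μ ρ)
          (i2.add (integrable_const 1)) fun p => ?_
        simp only
        nlinarith [sq_nonneg (f p.1 p.2 / marginal f μ p.1 - 1),
          h.likelihood_ratio_nonneg μ p.1 p.2]
    _ ≤ (B + 1) * ρ.real univ := by
        rw [integral_add i2 (integrable_const 1)]
        have := h.integral_sq_likelihood_ratio_le π μ ρ
        simp [measureReal_prod_prod, ← univ_prod_univ]
        linarith

theorem RatioBounded.integral_likelihood_ratio_eq (h : RatioBounded f B) (ρ : Measure Θ)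
    [IsFiniteMeasure ρ] :
    ∫ p, f p.1 p.2 / marginal f μ p.1 ∂((dataLaw f π).prod ρ)
      = ∫ x, marginal f ρ x / marginal f μ x ∂(dataLaw f π) := by
  have := h.isProbabilityMeasure_dataLaw π
  rw [integral_prod _ (h.integrable_likelihood_ratio π μ ρ)]
  refine integral_congr_ae (Eventually.of_forall fun x => ?_)
  simp only [marginal]
  rw [integral_div]

theorem RatioBounded.integrable_log_step (h : RatioBounded f B) (ρ : Measure Θ)
    [IsFiniteMeasure ρ] {c : ℝ} (hc : c ∈ Ioo (0 : ℝ) 1) :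
    Integrable (fun p : ℝ × Θ => Real.log (1 - c + c * (f p.1 p.2 / marginal f μ p.1)))
      ((dataLaw f π).prod ρ) := by
  have := h.isProbabilityMeasure_dataLaw π
  exact Integrable.mono' ((h.integrable_likelihood_ratio π μ ρ).add
      (integrable_const |Real.log (1 - c)|))
    (((h.measurable_likelihood_ratio μ).const_mul c).const_add (1 - c)).log.aestronglyMeasurable
    (Eventually.of_forall fun p => h.abs_log_step_le μ hc p.1 p.2)

theorem RatioBounded.lintegral_enorm_log_step_le (h : RatioBounded f B) (ρ : Measure Θ)
    [IsFiniteMeasure ρ] {c : ℝ} (hc : c ∈ Ioo (0 : ℝ) 1) :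
    ∫⁻ x, ‖∫ u, Real.log (1 - c + c * (f x u / marginal f μ x)) ∂ρ‖ₑ ∂(dataLaw f π)
      ≤ ENNReal.ofReal ((B + 1 + |Real.log (1 - c)|) * ρ.real univ) := by
  have := h.isProbabilityMeasure_dataLaw π
  have hi := h.integrable_log_step π μ ρ hc
  have i1 := h.integrable_likelihood_ratio π μ ρ
  calc ∫⁻ x, ‖∫ u, Real.log (1 - c + c * (f x u / marginal f μ x)) ∂ρ‖ₑ ∂(dataLaw f π)
      ≤ ∫⁻ x, ∫⁻ u, ‖Real.log (1 - c + c * (f x u / marginal f μ x))‖ₑ ∂ρ ∂(dataLaw f π) :=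
        lintegral_mono fun x => enorm_integral_le_lintegral_enorm _
    _ = ∫⁻ p, ‖Real.log (1 - c + c * (f p.1 p.2 / marginal f μ p.1))‖ₑ
          ∂((dataLaw f π).prod ρ) := (lintegral_prod _ hi.1.enorm).symm
    _ = ENNReal.ofReal (∫ p, ‖Real.log (1 - c + c * (f p.1 p.2 / marginal f μ p.1))‖
          ∂((dataLaw f π).prod ρ)) := (ofReal_integral_norm_eq_lintegral_enorm hi).symm
    _ ≤ _ := by
        refine ENNReal.ofReal_le_ofReal ?_
        have hle : ∫ p, ‖Real.log (1 - c + c * (f p.1 p.2 / marginal f μ p.1))‖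
            ∂((dataLaw f π).prod ρ) ≤ ∫ p, (f p.1 p.2 / marginal f μ p.1 + |Real.log (1 - c)|)
            ∂((dataLaw f π).prod ρ) :=
          integral_mono hi.norm (i1.add (integrable_const _))
            fun p => h.abs_log_step_le μ hc p.1 p.2
        rw [integral_add i1 (integrable_const _)] at hle
        have hmass : ((dataLaw f π).prod ρ).real univ = ρ.real univ := by
          rw [← univ_prod_univ, measureReal_prod_prod]; simp
        rw [integral_const, hmass, smul_eq_mul] at hle
        have := h.integral_likelihood_ratio_le π μ ρ
        linarith

/-- The expected gain, under a part `ρ` of the true prior, in the logarithm of the density of the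
predictive recursion estimate. -/
theorem RatioBounded.le_integral_log_step (h : RatioBounded f B) {A : Set Θ}
    (hA : MeasurableSet A) {c : ℝ} (hc : c ∈ Ioo (0 : ℝ) 1) :
    c * (kl f π μ - π.real Aᶜ * (B + 1)) - c ^ 2 / (1 - c) * (B + 1) ≤
      ∫ p, Real.log (1 - c + c * (f p.1 p.2 / marginal f μ p.1))
        ∂((dataLaw f π).prod (π.restrict A)) := by
  have := h.isProbabilityMeasure_dataLaw π
  set ν := dataLaw f π with hν
  set ρ := π.restrict A with hρ
  set K := c ^ 2 / (1 - c) with hK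
  have hc1 : 0 < 1 - c := by linarith [hc.2]
  have hK0 : 0 ≤ K := div_nonneg (sq_nonneg c) hc1.le
  have i1 := h.integrable_likelihood_ratio π μ ρ
  have i2 := h.integrable_sq_likelihood_ratio π μ ρ
  have i3 : Integrable (fun p : ℝ × Θ => f p.1 p.2 / marginal f μ p.1 - 1) (ν.prod ρ) :=
    i1.sub (integrable_const 1)
  have i4 : Integrable (fun p : ℝ × Θ => (f p.1 p.2 / marginal f μ p.1) ^ 2 + 1) (ν.prod ρ) :=
    i2.add (integrable_const 1)
  have hint := h.integrable_log_step π μ ρ hc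
  have key : ∫ p, (c * (f p.1 p.2 / marginal f μ p.1 - 1)
      - K * ((f p.1 p.2 / marginal f μ p.1) ^ 2 + 1)) ∂(ν.prod ρ)
      ≤ ∫ p, Real.log (1 - c + c * (f p.1 p.2 / marginal f μ p.1)) ∂(ν.prod ρ) :=
    integral_mono ((i3.const_mul c).sub (i4.const_mul K)) hint fun p =>
      sub_le_log_one_sub_add_mul hc (h.likelihood_ratio_nonneg μ p.1 p.2)
  rw [integral_sub (i3.const_mul c) (i4.const_mul K), integral_const_mul, integral_const_mul,
    integral_sub i1 (integrable_const 1), integral_add i2 (integrable_const 1)] at key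
  have hmass : (ν.prod ρ).real univ = ρ.real univ := by
    rw [← univ_prod_univ, measureReal_prod_prod]; simp
  simp only [integral_const, smul_eq_mul, mul_one] at key
  rw [← hν, hmass] at key
  have hρ1 : ρ.real univ ≤ 1 := by
    rw [hρ, measureReal_restrict_apply_univ]; exact measureReal_le_one
  have hsq := h.integral_sq_likelihood_ratio_le π μ ρ
  have hsq' : ∫ p, (f p.1 p.2 / marginal f μ p.1) ^ 2 ∂(ν.prod ρ) + ρ.real univ ≤ B + 1 := by
    nlinarith [h.bound_nonneg, measureReal_nonneg (μ := ρ) (s := univ)]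
  -- Over all of π the likelihood ratio integrates to ∫ m_π / m_μ dν ≥ 1 + `kl f π μ`; the part off
  -- A takes away at most (B + 1)π(Aᶜ).
  have hsplit : ∫ p, f p.1 p.2 / marginal f μ p.1 ∂(ν.prod π)
      = ∫ p, f p.1 p.2 / marginal f μ p.1 ∂(ν.prod ρ)
        + ∫ p, f p.1 p.2 / marginal f μ p.1 ∂(ν.prod (π.restrict Aᶜ)) := by
    rw [← integral_add_measure i1 (h.integrable_likelihood_ratio π μ _), ← Measure.prod_add,
      hρ, Measure.restrict_add_restrict_compl hA]
  have hkl := h.kl_le_integral_ratio_sub_one π μ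
  rw [← h.integral_likelihood_ratio_eq π μ π, hsplit] at hkl
  have hrest := h.integral_likelihood_ratio_le π μ (π.restrict Aᶜ)
  rw [measureReal_restrict_apply_univ] at hrest
  have h1 : c * (kl f π μ - π.real Aᶜ * (B + 1))
      ≤ c * (∫ p, f p.1 p.2 / marginal f μ p.1 ∂(ν.prod ρ) - ρ.real univ) :=
    mul_le_mul_of_nonneg_left (by linarith) hc.1.le
  have h2 := mul_le_mul_of_nonneg_left hsq' hK0
  linarith

end PartialPrior

/-! ### The recursion as a product density with respect to the initial guess -/

section Recursion

variable {Θ : Set ℝ} {f : ℝ → Θ → ℝ} {B : ℝ} {π₀ : Measure Θ} {γ : ℕ → ℝ}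

/-- The factor by which the `i`-th step of predictive recursion multiplies the density of the
estimate with respect to the initial guess. -/
noncomputable def prFactor (f : ℝ → Θ → ℝ) (π₀ : Measure Θ) (γ x : ℕ → ℝ) (i : ℕ) (u : Θ) : ℝ :=
  1 - γ i + γ i * (f (x i) u / marginal f (predictiveRecursion f π₀ γ x i) (x i))

theorem predictiveRecursion_congr {x x' : ℕ → ℝ} {n : ℕ} (hx : ∀ i < n, x i = x' i) :
    predictiveRecursion f π₀ γ x n = predictiveRecursion f π₀ γ x' n := by
  induction n with
  | zero => rfl
  | succ n ih =>
    simp only [predictiveRecursion]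
    rw [ih fun i hi => hx i (by omega), hx n (by omega)]

theorem RatioBounded.prFactor_pos (h : RatioBounded f B) (hγ : ∀ i, γ i ∈ Ioo (0 : ℝ) 1)
    (x : ℕ → ℝ) (i : ℕ) (u : Θ) : 0 < prFactor f π₀ γ x i u := by
  have := mul_nonneg (hγ i).1.le
    (h.likelihood_ratio_nonneg (predictiveRecursion f π₀ γ x i) (x i) u)
  have := (hγ i).2
  unfold prFactor
  linarith

theorem RatioBounded.measurable_prFactor_right (h : RatioBounded f B) (x : ℕ → ℝ) (i : ℕ) :
    Measurable (prFactor f π₀ γ x i) :=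
  ((((h.measurable.of_uncurry_left).div_const _).const_mul (γ i)).const_add (1 - γ i))

/-- The product form serves twice: it reduces measurability in the data to integrals against the
fixed measure π₀, and it turns the log-density into a sum over steps. It needs no positivity of the
marginals. -/
theorem RatioBounded.predictiveRecursion_eq_withDensity (h : RatioBounded f B)
    (hγ : ∀ i, γ i ∈ Ioo (0 : ℝ) 1) (x : ℕ → ℝ) (n : ℕ) :
    predictiveRecursion f π₀ γ x n
      = π₀.withDensity fun u => ∏ i ∈ Finset.range n, ENNReal.ofReal (prFactor f π₀ γ x i u) := by
  induction n with
  | zero =>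
    have : (fun _ : Θ => (1 : ℝ≥0∞)) = 1 := rfl
    simp [predictiveRecursion, this]
  | succ n ih =>
    have hW : Measurable fun u : Θ =>
        ∏ i ∈ Finset.range n, ENNReal.ofReal (prFactor f π₀ γ x i u) :=
      Finset.measurable_prod _ fun i _ => (h.measurable_prFactor_right x i).ennreal_ofReal
    set μ := predictiveRecursion f π₀ γ x n with hμ
    have hg : Measurable fun u : Θ => ENNReal.ofReal (f (x n) u / marginal f μ (x n)) :=
      ((h.measurable.of_uncurry_left).div_const _).ennreal_ofReal
    have h1 : predictiveRecursion f π₀ γ x (n + 1) = prStep f (γ n) (x n) μ := rfl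
    have h2 : prStep f (γ n) (x n) μ
        = μ.withDensity fun u => ENNReal.ofReal (prFactor f π₀ γ x n u) := by
      have e : (fun u : Θ => ENNReal.ofReal (prFactor f π₀ γ x n u))
          = (fun _ => ENNReal.ofReal (1 - γ n)) + ENNReal.ofReal (γ n) •
            fun u : Θ => ENNReal.ofReal (f (x n) u / marginal f μ (x n)) := by
        ext u
        simp only [prFactor, Pi.add_apply, Pi.smul_apply, smul_eq_mul]
        rw [← hμ, ENNReal.ofReal_add (by linarith [(hγ n).2])
          (mul_nonneg (hγ n).1.le (h.likelihood_ratio_nonneg _ _ _)),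
          ENNReal.ofReal_mul (hγ n).1.le]
      rw [e, withDensity_add_left measurable_const, withDensity_const,
        withDensity_smul _ hg]
      rfl
    rw [h1, h2, ih, ← withDensity_mul _ hW (h.measurable_prFactor_right x n).ennreal_ofReal]
    congr 1
    ext u
    simp [Finset.prod_range_succ]

/-- Strong induction, since the n-th product density contains the earlier mixtures evaluated at the
earlier observations. -/
theorem RatioBounded.measurable_marginal_predictiveRecursion [SFinite π₀] (h : RatioBounded f B)
    (hγ : ∀ i, γ i ∈ Ioo (0 : ℝ) 1) (n : ℕ) :
    Measurable fun p : (ℕ → ℝ) × ℝ => marginal f (predictiveRecursion f π₀ γ p.1 n) p.2 := by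
  induction n using Nat.strong_induction_on with
  | _ n ih =>
    have hfac : ∀ i < n, Measurable fun p : (ℕ → ℝ) × Θ => prFactor f π₀ γ p.1 i p.2 := by
      intro i hi
      have hxi : Measurable fun p : (ℕ → ℝ) × Θ => p.1 i := (measurable_pi_apply i).comp measurable_fst
      have m1 : Measurable fun p : (ℕ → ℝ) × Θ => f (p.1 i) p.2 :=
        h.measurable.comp (hxi.prodMk measurable_snd)
      have m2 : Measurable fun p : (ℕ → ℝ) × Θ =>
          marginal f (predictiveRecursion f π₀ γ p.1 i) (p.1 i) :=
        (ih i hi).comp (measurable_fst.prodMk hxi)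
      exact ((m1.fun_div m2).const_mul (γ i)).const_add (1 - γ i)
    have e : (fun p : (ℕ → ℝ) × ℝ => marginal f (predictiveRecursion f π₀ γ p.1 n) p.2)
        = fun p : (ℕ → ℝ) × ℝ => (∫⁻ u, (∏ i ∈ Finset.range n,
          ENNReal.ofReal (prFactor f π₀ γ p.1 i u)) * ENNReal.ofReal (f p.2 u) ∂π₀).toReal := by
      ext p
      rw [h.marginal_eq_toReal, h.predictiveRecursion_eq_withDensity hγ,
        lintegral_withDensity_eq_lintegral_mul _ _ (h.measurable.of_uncurry_left).ennreal_ofReal]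
      · rfl
      · exact Finset.measurable_prod _ fun i _ => (h.measurable_prFactor_right p.1 i).ennreal_ofReal
    rw [e]
    refine (Measurable.lintegral_prod_right' (f := fun q : ((ℕ → ℝ) × ℝ) × Θ =>
      (∏ i ∈ Finset.range n, ENNReal.ofReal (prFactor f π₀ γ q.1.1 i q.2))
        * ENNReal.ofReal (f q.1.2 q.2)) ?_).ennreal_toReal
    refine Measurable.mul (Finset.measurable_prod _ fun i hi => ?_)
      (h.measurable_ofReal.comp (measurable_fst.snd.prodMk measurable_snd))
    exact ((hfac i (Finset.mem_range.1 hi)).comp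
      (measurable_fst.fst.prodMk measurable_snd)).ennreal_ofReal

theorem RatioBounded.measurable_prFactor [SFinite π₀] (h : RatioBounded f B)
    (hγ : ∀ i, γ i ∈ Ioo (0 : ℝ) 1) (i : ℕ) :
    Measurable fun p : ((ℕ → ℝ) × ℝ) × Θ => 1 - γ i
      + γ i * (f p.1.2 p.2 / marginal f (predictiveRecursion f π₀ γ p.1.1 i) p.1.2) := by
  have m1 : Measurable fun p : ((ℕ → ℝ) × ℝ) × Θ => f p.1.2 p.2 :=
    h.measurable.comp (measurable_fst.snd.prodMk measurable_snd)
  exact ((m1.fun_div ((h.measurable_marginal_predictiveRecursion hγ i).comp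
    measurable_fst)).const_mul (γ i)).const_add (1 - γ i)

theorem RatioBounded.measurable_kl_predictiveRecursion (π : Measure Θ) [IsProbabilityMeasure π]
    [SFinite π₀] (h : RatioBounded f B) (hγ : ∀ i, γ i ∈ Ioo (0 : ℝ) 1) (n : ℕ) :
    Measurable fun x : ℕ → ℝ => kl f π (predictiveRecursion f π₀ γ x n) := by
  have := h.isProbabilityMeasure_dataLaw π
  have hm : Measurable fun p : (ℕ → ℝ) × ℝ =>
      Real.log (marginal f π p.2 / marginal f (predictiveRecursion f π₀ γ p.1 n) p.2) :=
    (((h.measurable_marginal π).comp measurable_snd).fun_div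
      (h.measurable_marginal_predictiveRecursion hγ n)).log
  exact (hm.stronglyMeasurable.integral_prod_right' (ν := dataLaw f π)).measurable

end Recursion

/-! ### Independence of the next observation from the past -/

section Past

/-- The sequence `x` with the terms from the `n`-th on erased. -/
noncomputable def past (n : ℕ) (x : ℕ → ℝ) : ℕ → ℝ := fun i => if i < n then x i else 0

theorem measurable_past (n : ℕ) : Measurable (past n) := by
  refine measurable_pi_lambda _ fun i => ?_
  unfold past
  split_ifs
  · exact measurable_pi_apply i
  · exact measurable_const

theorem past_past {m n : ℕ} (hmn : m ≤ n) (x : ℕ → ℝ) : past m (past n x) = past m x := by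
  ext i
  unfold past
  split_ifs <;> first | rfl | omega

theorem predictiveRecursion_past {Θ : Set ℝ} {f : ℝ → Θ → ℝ} {π₀ : Measure Θ} {γ : ℕ → ℝ}
    (n : ℕ) (x : ℕ → ℝ) :
    predictiveRecursion f π₀ γ (past n x) n = predictiveRecursion f π₀ γ x n :=
  predictiveRecursion_congr fun i hi => by simp [past, hi]

variable {Ω : Type*} [MeasurableSpace Ω] {P : Measure Ω} [IsProbabilityMeasure P]
  {X : ℕ → Ω → ℝ} {ν : Measure ℝ}

theorem measurable_past_comp (hXm : ∀ i, Measurable (X i)) (n : ℕ) :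
    Measurable fun ω => past n (fun i => X i ω) :=
  (measurable_past n).comp (measurable_pi_lambda _ hXm)

/-- The past is a function of the finite block of coordinates below n, which is independent of
coordinate n. -/
theorem map_past_prodMk (hXm : ∀ i, Measurable (X i)) (hXi : iIndepFun X P)
    (hXl : ∀ i, P.map (X i) = ν) (n : ℕ) :
    P.map (fun ω => (past n (fun i => X i ω), X n ω))
      = (P.map fun ω => past n (fun i => X i ω)).prod ν := by
  have hind : IndepFun (fun ω => past n (fun i => X i ω)) (X n) P := by
    have h1 := hXi.indepFun_finset (Finset.range n) {n} (by simp) hXm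
    let φ : (Finset.range n → ℝ) → ℕ → ℝ := fun z i =>
      if hi : i ∈ Finset.range n then z ⟨i, hi⟩ else 0
    have hφ : Measurable φ := by
      refine measurable_pi_lambda _ fun i => ?_
      by_cases hi : i ∈ Finset.range n
      · simp only [φ, hi, dite_true]; exact measurable_pi_apply _
      · simp only [φ, hi, dite_false]; exact measurable_const
    have hψ : Measurable fun z : ({n} : Finset ℕ) → ℝ => z ⟨n, Finset.mem_singleton_self n⟩ :=
      measurable_pi_apply _
    have h2 := h1.comp hφ hψ
    convert h2 using 1
    · ext ω i
      simp [φ, past]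
    · rfl
  rw [(indepFun_iff_map_prod_eq_prod_map_map (measurable_past_comp hXm n).aemeasurable
    (hXm n).aemeasurable).1 hind, hXl]

theorem lintegral_past (hXm : ∀ i, Measurable (X i)) (hXi : iIndepFun X P)
    (hXl : ∀ i, P.map (X i) = ν) (n : ℕ) {g : (ℕ → ℝ) × ℝ → ℝ≥0∞} (hg : Measurable g) :
    ∫⁻ ω, g (past n (fun i => X i ω), X n ω) ∂P
      = ∫⁻ ω, ∫⁻ x, g (past n (fun i => X i ω), x) ∂ν ∂P := by
  have hp := measurable_past_comp hXm n
  have : IsProbabilityMeasure ν := hXl 0 ▸ Measure.isProbabilityMeasure_map (hXm 0).aemeasurable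
  rw [← lintegral_map hg (hp.prodMk (hXm n)), map_past_prodMk hXm hXi hXl,
    lintegral_prod _ hg.aemeasurable,
    lintegral_map (f := fun z => ∫⁻ x, g (z, x) ∂ν) hg.lintegral_prod_right' hp]

theorem integrable_integral_past (hXm : ∀ i, Measurable (X i)) (hXi : iIndepFun X P)
    (hXl : ∀ i, P.map (X i) = ν) (n : ℕ) {g : (ℕ → ℝ) × ℝ → ℝ} (hg : Measurable g)
    (hgi : Integrable (fun ω => g (past n (fun i => X i ω), X n ω)) P) :
    Integrable (fun ω => ∫ x, g (past n (fun i => X i ω), x) ∂ν) P ∧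
    ∫ ω, g (past n (fun i => X i ω), X n ω) ∂P
      = ∫ ω, ∫ x, g (past n (fun i => X i ω), x) ∂ν ∂P := by
  have hp := measurable_past_comp hXm n
  have : IsProbabilityMeasure ν := hXl 0 ▸ Measure.isProbabilityMeasure_map (hXm 0).aemeasurable
  have : IsProbabilityMeasure (P.map fun ω => past n (fun i => X i ω)) :=
    Measure.isProbabilityMeasure_map hp.aemeasurable
  have hpx := hp.prodMk (hXm n)
  have hi : Integrable g ((P.map fun ω => past n (fun i => X i ω)).prod ν) := by
    rw [← map_past_prodMk hXm hXi hXl, integrable_map_measure hg.aestronglyMeasurable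
      hpx.aemeasurable]
    exact hgi
  have hm := hg.stronglyMeasurable.integral_prod_right' (ν := ν)
  constructor
  · exact (integrable_map_measure hm.aestronglyMeasurable hp.aemeasurable).1 hi.integral_prod_left
  · rw [← integral_map hpx.aemeasurable hg.aestronglyMeasurable, map_past_prodMk hXm hXi hXl,
      integral_prod _ hi, integral_map hp.aemeasurable hm.aestronglyMeasurable]

/-- The indicator of an event of the past is absorbed into g. This plays the role of a conditional
expectation given the past. -/
theorem setIntegral_past (hXm : ∀ i, Measurable (X i)) (hXi : iIndepFun X P)
    (hXl : ∀ i, P.map (X i) = ν) (n : ℕ) {g : (ℕ → ℝ) × ℝ → ℝ} (hg : Measurable g)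
    (hgi : Integrable (fun ω => g (past n (fun i => X i ω), X n ω)) P)
    {S : Set (ℕ → ℝ)} (hS : MeasurableSet S) :
    ∫ ω in (fun ω => past n (fun i => X i ω)) ⁻¹' S, g (past n (fun i => X i ω), X n ω) ∂P
      = ∫ ω in (fun ω => past n (fun i => X i ω)) ⁻¹' S,
        ∫ x, g (past n (fun i => X i ω), x) ∂ν ∂P := by
  have hp := measurable_past_comp hXm n
  have hS' : MeasurableSet ((fun ω => past n (fun i => X i ω)) ⁻¹' S) := hp hS
  rw [← integral_indicator hS', ← integral_indicator hS']
  have hg' : Measurable ((Prod.fst ⁻¹' S).indicator g) := hg.indicator (measurable_fst hS)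
  have h1 := (integrable_integral_past hXm hXi hXl n hg' (hgi.indicator hS')).2
  refine h1.trans ?_
  congr 1
  ext ω
  by_cases hω : past n (fun i => X i ω) ∈ S
  · simp [indicator, hω]
  · simp [indicator, hω]

/-- The filtration generated by the successive pasts of a data sequence. -/
noncomputable def pastFiltration {Ω : Type*} {mΩ : MeasurableSpace Ω} (X : ℕ → Ω → ℝ)
    (hXm : ∀ i, Measurable (X i)) : Filtration ℕ mΩ where
  seq n := MeasurableSpace.comap (fun ω => past n (fun i => X i ω)) inferInstance
  mono' m n hmn := by
    have e : (fun ω => past m (fun i => X i ω)) = past m ∘ fun ω => past n (fun i => X i ω) := by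
      ext1 ω; exact (past_past hmn _).symm
    simp only
    rw [e, ← MeasurableSpace.comap_comp]
    exact MeasurableSpace.comap_mono (measurable_past m).comap_le
  le' n := (measurable_past_comp hXm n).comap_le

end Past

/-! ### Weighted sums, and truncation of the density of π -/

theorem summable_sq_div_one_sub {γ : ℕ → ℝ}
    (hsq : Summable fun i => γ i ^ 2) : Summable fun i => γ i ^ 2 / (1 - γ i) := by
  have h0 : ∀ᶠ i in atTop, γ i ^ 2 < (1 / 2) ^ 2 :=
    hsq.tendsto_atTop_zero.eventually_lt_const (by norm_num)
  refine Summable.of_norm_bounded_eventually_nat (hsq.mul_left 2) ?_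
  filter_upwards [h0] with i hi
  have h1 : γ i < 1 / 2 := lt_of_pow_lt_pow_left₀ 2 (by norm_num) hi
  rw [Real.norm_of_nonneg (div_nonneg (sq_nonneg _) (by linarith)), div_le_iff₀ (by linarith)]
  nlinarith [sq_nonneg (γ i)]

/-- Weighted averages, with weights of infinite total mass, cannot stay below the limit. -/
theorem nonpos_of_weighted_sum_le {a γ : ℕ → ℝ} {L : ℝ} (ha : Tendsto a atTop (𝓝 L))
    (hγ : ∀ i, 0 ≤ γ i) (hγs : ¬ Summable γ)
    (hb : ∀ δ : ℝ, 0 < δ → ∃ C : ℝ, ∀ n,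
      ∑ i ∈ Finset.range n, γ i * a i ≤ C + δ * ∑ i ∈ Finset.range n, γ i) : L ≤ 0 := by
  by_contra! hL
  -- Eventually a > L/2, so a - L/4 ≥ L/4; the bound with δ = L/4 then bounds the tail sums of γ.
  obtain ⟨C, hC⟩ := hb (L / 4) (by linarith)
  obtain ⟨N, hN⟩ := eventually_atTop.1 (ha.eventually_const_lt (show L / 2 < L by linarith))
  apply hγs
  rw [← summable_nat_add_iff N]
  refine summable_of_sum_range_le (c := (C - ∑ i ∈ Finset.range N, γ i * (a i - L / 4)) / (L / 4))
    (fun n => hγ _) fun n => ?_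
  rw [le_div_iff₀ (by linarith), Finset.sum_mul]
  have h1 : ∑ i ∈ Finset.range n, γ (i + N) * (L / 4)
      ≤ ∑ i ∈ Finset.range n, γ (N + i) * (a (N + i) - L / 4) := by
    refine Finset.sum_le_sum fun i _ => ?_
    rw [add_comm i N]
    have := hN (N + i) (by omega)
    exact mul_le_mul_of_nonneg_left (by linarith) (hγ _)
  have h2 := Finset.sum_range_add (fun i => γ i * (a i - L / 4)) N n
  have h3 : ∑ i ∈ Finset.range (N + n), γ i * (a i - L / 4) ≤ C := by
    have := hC (N + n)
    simp only [mul_sub, Finset.sum_sub_distrib]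
    rw [← Finset.sum_mul]
    linarith
  linarith

/-- A is a sublevel set {dπ/dπ₀ ≤ k}; the superlevel sets decrease to a π-null set because the
density is finite almost everywhere. -/
theorem exists_restrict_le_smul {T : Type*} [MeasurableSpace T] {π π₀ : Measure T}
    [IsFiniteMeasure π] [SigmaFinite π₀] (hπ : π ≪ π₀) {δ : ℝ} (hδ : 0 < δ) :
    ∃ A, MeasurableSet A ∧ ∃ M : ℕ, π.restrict A ≤ (M : ℝ≥0∞) • π₀ ∧ π.real Aᶜ ≤ δ := by
  set r := π.rnDeriv π₀ with hr
  have hrm : Measurable r := Measure.measurable_rnDeriv _ _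
  have hrπ : π₀.withDensity r = π := Measure.withDensity_rnDeriv_eq _ _ hπ
  have hlim : Tendsto (fun k : ℕ => π {x | (k : ℝ≥0∞) < r x}) atTop
      (𝓝 (π (⋂ k : ℕ, {x | (k : ℝ≥0∞) < r x}))) := by
    refine tendsto_measure_iInter_atTop
      (fun k => (measurableSet_lt measurable_const hrm).nullMeasurableSet) ?_
      ⟨0, measure_ne_top _ _⟩
    intro i j hij x hx
    exact (show (i : ℝ≥0∞) ≤ j by exact_mod_cast hij).trans_lt hx
  have hz : π (⋂ k : ℕ, {x | (k : ℝ≥0∞) < r x}) = 0 := by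
    have h1 : ∀ᵐ x ∂π, r x < ∞ := hπ.ae_le (Measure.rnDeriv_lt_top π π₀)
    refine measure_mono_null ?_ h1
    intro x hx hlt
    obtain ⟨k, hk⟩ := ENNReal.exists_nat_gt hlt.ne
    exact lt_asymm hk (mem_iInter.1 hx k)
  rw [hz] at hlim
  obtain ⟨k, hk⟩ := (hlim.eventually_lt_const
    (show (0 : ℝ≥0∞) < ENNReal.ofReal δ by simpa using hδ)).exists
  refine ⟨{x | r x ≤ k}, measurableSet_le hrm measurable_const, k, ?_, ?_⟩
  · refine Measure.le_iff.2 fun s hs => ?_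
    rw [Measure.restrict_apply hs, ← hrπ, withDensity_apply _
      (hs.inter (measurableSet_le hrm measurable_const))]
    calc ∫⁻ x in s ∩ {x | r x ≤ k}, r x ∂π₀ ≤ ∫⁻ _ in s ∩ {x | r x ≤ k}, (k : ℝ≥0∞) ∂π₀ :=
          setLIntegral_mono measurable_const fun x hx => hx.2
      _ = k * π₀ (s ∩ {x | r x ≤ k}) := by simp
      _ ≤ k * π₀ s := by gcongr; exact inter_subset_left
      _ = _ := by simp
  · have : {x | r x ≤ (k : ℝ≥0∞)}ᶜ = {x | (k : ℝ≥0∞) < r x} := by ext; simp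
    rw [this]
    exact ENNReal.toReal_le_of_le_ofReal hδ.le hk.le

/-! ### Consistency of the estimated mixture -/

section EstimateFromData

variable {Θ : Set ℝ} {f : ℝ → Θ → ℝ} {π₀ : Measure Θ} {γ : ℕ → ℝ} {Ω : Type*} {X : ℕ → Ω → ℝ}

/-- The predictive recursion estimate from random data. -/
noncomputable def prEstimate (f : ℝ → Θ → ℝ) (π₀ : Measure Θ) (γ : ℕ → ℝ) (X : ℕ → Ω → ℝ)
    (n : ℕ) (ω : Ω) : Measure Θ :=
  predictiveRecursion f π₀ γ (fun i => X i ω) n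

theorem prEstimate_eq_past (n : ℕ) (ω : Ω) :
    prEstimate f π₀ γ X n ω = predictiveRecursion f π₀ γ (past n fun i => X i ω) n :=
  (predictiveRecursion_past n _).symm

theorem prEstimate_succ (n : ℕ) (ω : Ω) :
    prEstimate f π₀ γ X (n + 1) ω = prStep f (γ n) (X n ω) (prEstimate f π₀ γ X n ω) := rfl

end EstimateFromData

section Estimate

variable {Θ : Set ℝ} {f : ℝ → Θ → ℝ} {B : ℝ} {π π₀ : Measure Θ} {γ : ℕ → ℝ}
  [IsProbabilityMeasure π] [IsProbabilityMeasure π₀]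
  {Ω : Type*} [mΩ : MeasurableSpace Ω] {P : Measure Ω} [IsProbabilityMeasure P] {X : ℕ → Ω → ℝ}

theorem RatioBounded.measurable_kl_prEstimate (h : RatioBounded f B)
    (hγ : ∀ i, γ i ∈ Ioo (0 : ℝ) 1) (hXm : ∀ i, Measurable (X i)) (n : ℕ) :
    Measurable fun ω => kl f π (prEstimate f π₀ γ X n ω) :=
  (h.measurable_kl_predictiveRecursion π hγ n).comp (measurable_pi_lambda _ hXm)

theorem RatioBounded.measurable_kl_prStep (h : RatioBounded f B)
    (hγ : ∀ i, γ i ∈ Ioo (0 : ℝ) 1) (n : ℕ) :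
    Measurable fun p : (ℕ → ℝ) × ℝ =>
      kl f π (prStep f (γ n) p.2 (predictiveRecursion f π₀ γ p.1 n)) := by
  have hu : Measurable fun p : (ℕ → ℝ) × ℝ => Function.update p.1 n p.2 := by
    refine measurable_pi_lambda _ fun i => ?_
    by_cases hi : i = n
    · subst hi; simpa using measurable_snd
    · simp only [Function.update_of_ne hi]
      exact (measurable_pi_apply i).comp measurable_fst
  have e : (fun p : (ℕ → ℝ) × ℝ =>
      kl f π (prStep f (γ n) p.2 (predictiveRecursion f π₀ γ p.1 n)))
      = fun p => kl f π (predictiveRecursion f π₀ γ (Function.update p.1 n p.2) (n + 1)) := by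
    ext p
    have e1 : predictiveRecursion f π₀ γ (Function.update p.1 n p.2) n
        = predictiveRecursion f π₀ γ p.1 n :=
      predictiveRecursion_congr fun i hi => Function.update_of_ne hi.ne _ _
    rw [predictiveRecursion, e1, Function.update_self]
  rw [e]
  exact (h.measurable_kl_predictiveRecursion π hγ (n + 1)).comp hu

variable (h : RatioBounded f B) (hγ : ∀ i, γ i ∈ Ioo (0 : ℝ) 1) (hXm : ∀ i, Measurable (X i))
  (hXi : iIndepFun X P) (hXl : ∀ i, P.map (X i) = dataLaw f π)

include h hγ hXm hXi hXl

/-- A step preserves total mass if the current mixture is positive at the new observation. For a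
fixed past this holds for almost every value of the observation, by mutual absolute continuity;
independence from the past makes it almost sure. -/
theorem ae_isProbabilityMeasure_prEstimate :
    ∀ᵐ ω ∂P, ∀ n, IsProbabilityMeasure (prEstimate f π₀ γ X n ω) := by
  rw [ae_all_iff]
  intro n
  induction n with
  | zero => exact Eventually.of_forall fun ω => ‹IsProbabilityMeasure π₀›
  | succ n ih =>
    have hm := h.measurable_marginal_predictiveRecursion (π₀ := π₀) hγ n
    set bad : Set ((ℕ → ℝ) × ℝ) :=
      {p | 0 < marginal f (predictiveRecursion f π₀ γ p.1 n) p.2}ᶜ with hbad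
    have hbm : MeasurableSet bad := (measurableSet_lt measurable_const hm).compl
    have hg : Measurable (bad.indicator fun _ => (1 : ℝ≥0∞)) := measurable_const.indicator hbm
    have h0 : ∫⁻ ω, bad.indicator (fun _ => (1 : ℝ≥0∞)) (past n (fun i => X i ω), X n ω) ∂P = 0 := by
      rw [lintegral_past hXm hXi hXl n hg]
      have : ∫⁻ _ : Ω, (0 : ℝ≥0∞) ∂P = 0 := by simp
      rw [← this]
      refine lintegral_congr_ae ?_
      filter_upwards [ih] with ω hω
      have : ∫⁻ _ : ℝ, (0 : ℝ≥0∞) ∂(dataLaw f π) = 0 := by simp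
      rw [← this]
      refine lintegral_congr_ae ?_
      filter_upwards [h.ae_marginal_pos π (prEstimate f π₀ γ X n ω)] with x hx
      rw [prEstimate_eq_past] at hx
      simp [hbad, hx]
    have h0 := (lintegral_eq_zero_iff
      (hg.comp ((measurable_past_comp hXm n).prodMk (hXm n)))).1 h0
    filter_upwards [ih, h0] with ω hω h0ω
    have hpos : 0 < marginal f (prEstimate f π₀ γ X n ω) (X n ω) := by
      by_contra hneg
      rw [prEstimate_eq_past] at hneg
      simp [hbad, hneg] at h0ω
    rw [prEstimate_succ]
    exact h.isProbabilityMeasure_prStep _ (hγ n) hpos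

theorem ae_norm_kl_prEstimate_le :
    ∀ᵐ ω ∂P, ∀ n, ‖kl f π (prEstimate f π₀ γ X n ω)‖ ≤ B := by
  filter_upwards [ae_isProbabilityMeasure_prEstimate (π₀ := π₀) h hγ hXm hXi hXl] with ω hω n
  have := hω n
  rw [Real.norm_of_nonneg (h.kl_nonneg _ _)]
  exact h.kl_le _ _

theorem integrable_kl_prEstimate (n : ℕ) :
    Integrable (fun ω => kl f π (prEstimate f π₀ γ X n ω)) P := by
  refine Integrable.of_bound (h.measurable_kl_prEstimate hγ hXm n).aestronglyMeasurable B ?_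
  filter_upwards [ae_norm_kl_prEstimate_le (π₀ := π₀) h hγ hXm hXi hXl] with ω hω using hω n

/-- The expected one-step increase of the divergence is at most the compensating term; the sign is
reversed to obtain a submartingale. -/
theorem submartingale_sub_kl_prEstimate :
    Submartingale (fun n ω => ∑ i ∈ Finset.range n, γ i ^ 2 / (1 - γ i) * (B + 1)
      - kl f π (prEstimate f π₀ γ X n ω)) (pastFiltration X hXm) P := by
  have hint := integrable_kl_prEstimate (π₀ := π₀) h hγ hXm hXi hXl
  refine submartingale_of_setIntegral_le_succ (fun n => ?_)
    (fun n => (integrable_const _).sub (hint n)) fun n s hs => ?_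
  · have hmeas : Measurable[pastFiltration X hXm n]
        fun ω => kl f π (prEstimate f π₀ γ X n ω) := by
      have e : (fun ω => kl f π (prEstimate f π₀ γ X n ω))
          = (fun z => kl f π (predictiveRecursion f π₀ γ z n))
            ∘ fun ω => past n (fun i => X i ω) := by
        ext ω; rw [prEstimate_eq_past]; rfl
      rw [e]
      exact (h.measurable_kl_predictiveRecursion π hγ n).comp (comap_measurable _)
    exact (hmeas.const_sub _).stronglyMeasurable
  · obtain ⟨S, hS, rfl⟩ := hs
    have hS' : MeasurableSet ((fun ω => past n (fun i => X i ω)) ⁻¹' S) :=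
      measurable_past_comp hXm n hS
    rw [integral_sub (integrable_const _) (hint n).integrableOn,
      integral_sub (integrable_const _) (hint (n + 1)).integrableOn, Finset.sum_range_succ]
    have hg := h.measurable_kl_prStep (π := π) (π₀ := π₀) hγ n
    have e : ∀ ω, kl f π (prEstimate f π₀ γ X (n + 1) ω)
        = kl f π (prStep f (γ n) (X n ω) (predictiveRecursion f π₀ γ (past n fun i => X i ω) n)) :=
      fun ω => by rw [prEstimate_succ, prEstimate_eq_past]
    have hgi := (hint (n + 1)).congr (Eventually.of_forall e)
    have h1 := setIntegral_past hXm hXi hXl n hg hgi hS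
    have h2 := (integrable_integral_past hXm hXi hXl n hg hgi).1
    have h3 : ∫ ω in (fun ω => past n (fun i => X i ω)) ⁻¹' S,
        kl f π (prEstimate f π₀ γ X (n + 1) ω) ∂P
        ≤ ∫ ω in (fun ω => past n (fun i => X i ω)) ⁻¹' S,
          (kl f π (prEstimate f π₀ γ X n ω) + γ n ^ 2 / (1 - γ n) * (B + 1)) ∂P := by
      simp_rw [e]
      rw [h1]
      refine integral_mono_ae h2.integrableOn ((hint n).add (integrable_const _)).integrableOn ?_
      refine ae_restrict_of_ae ?_
      filter_upwards [ae_isProbabilityMeasure_prEstimate (π₀ := π₀) h hγ hXm hXi hXl] with ω hω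
      have := hω n
      have := h.integral_kl_prStep_le π (prEstimate f π₀ γ X n ω) (hγ n)
      rw [prEstimate_eq_past] at this ⊢
      exact this
    rw [integral_add (hint n).integrableOn (integrable_const _)] at h3
    rw [integral_const, integral_const] at *
    simp only [smul_eq_mul, mul_add] at *
    linarith

/-- The compensator is bounded by its total T and the divergence by B, so the submartingale is
bounded in L¹ and converges; subtracting it from the convergent compensator leaves the divergence.
-/
theorem exists_ae_tendsto_kl_prEstimate (hsq : Summable fun i => γ i ^ 2) :
    ∃ g : Ω → ℝ, ∀ᵐ ω ∂P, Tendsto (fun n => kl f π (prEstimate f π₀ γ X n ω)) atTop (𝓝 (g ω)) := by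
  have hs := (summable_sq_div_one_sub hsq).mul_right (B + 1)
  have hnn : ∀ i, 0 ≤ γ i ^ 2 / (1 - γ i) * (B + 1) := fun i =>
    mul_nonneg (div_nonneg (sq_nonneg _) (by linarith [(hγ i).2])) (by linarith [h.bound_nonneg])
  set T := ∑' i, γ i ^ 2 / (1 - γ i) * (B + 1) with hT
  have hsub := submartingale_sub_kl_prEstimate (π₀ := π₀) h hγ hXm hXi hXl
  have hbdd : ∀ n, eLpNorm (fun ω => ∑ i ∈ Finset.range n, γ i ^ 2 / (1 - γ i) * (B + 1)
      - kl f π (prEstimate f π₀ γ X n ω)) 1 P ≤ ((T + B).toNNReal : ℝ≥0∞) := fun n => by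
    refine (eLpNorm_le_of_ae_bound (C := T + B) ?_).trans ?_
    · filter_upwards [ae_norm_kl_prEstimate_le (π₀ := π₀) h hγ hXm hXi hXl] with ω hω
      refine (norm_sub_le _ _).trans (add_le_add ?_ (hω n))
      rw [Real.norm_of_nonneg (Finset.sum_nonneg fun i _ => hnn i)]
      exact hs.sum_le_tsum _ fun i _ => hnn i
    · simp [ENNReal.ofReal]
  obtain ⟨ℓ, hlim⟩ : ∃ ℓ : Ω → ℝ, ∀ᵐ ω ∂P, Tendsto (fun n => ∑ i ∈ Finset.range n,
      γ i ^ 2 / (1 - γ i) * (B + 1) - kl f π (prEstimate f π₀ γ X n ω)) atTop (𝓝 (ℓ ω)) :=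
    ⟨_, hsub.ae_tendsto_limitProcess hbdd⟩
  refine ⟨fun ω => T - ℓ ω, ?_⟩
  filter_upwards [hlim] with ω hω
  have := hs.hasSum.tendsto_sum_nat.sub hω
  simpa using this

/-- Given the past, the new observation follows the data law, so the one-step gain bound is averaged
over the past. Integrability is recorded because the gains are summed under the expectation. -/
theorem integral_kl_le_integral_log_prFactor {A : Set Θ} (hA : MeasurableSet A) (n : ℕ) :
    Integrable (fun ω => ∫ u in A, Real.log (prFactor f π₀ γ (fun i => X i ω) n u) ∂π) P ∧
    γ n * (∫ ω, kl f π (prEstimate f π₀ γ X n ω) ∂P - π.real Aᶜ * (B + 1))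
      - γ n ^ 2 / (1 - γ n) * (B + 1)
      ≤ ∫ ω, ∫ u in A, Real.log (prFactor f π₀ γ (fun i => X i ω) n u) ∂π ∂P := by
  have hint := integrable_kl_prEstimate (π₀ := π₀) h hγ hXm hXi hXl n
  have hprob := ae_isProbabilityMeasure_prEstimate (π₀ := π₀) h hγ hXm hXi hXl
  set g : (ℕ → ℝ) × ℝ → ℝ := fun p => ∫ u in A, Real.log (1 - γ n
      + γ n * (f p.2 u / marginal f (predictiveRecursion f π₀ γ p.1 n) p.2)) ∂π with hg
  have hgm : Measurable g :=
    ((h.measurable_prFactor (π₀ := π₀) hγ n).log.stronglyMeasurable.integral_prod_right'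
      (ν := π.restrict A)).measurable
  have e : ∀ ω, ∫ u in A, Real.log (prFactor f π₀ γ (fun i => X i ω) n u) ∂π
      = g (past n (fun i => X i ω), X n ω) := fun ω => by
    simp only [hg, prFactor, predictiveRecursion_past]
  simp_rw [e]
  have hgi : Integrable (fun ω => g (past n (fun i => X i ω), X n ω)) P := by
    refine ⟨(hgm.comp ((measurable_past_comp hXm n).prodMk (hXm n))).aestronglyMeasurable, ?_⟩
    rw [hasFiniteIntegral_iff_enorm, lintegral_past hXm hXi hXl n (g := fun p => ‖g p‖ₑ) hgm.enorm]
    refine lt_of_le_of_lt (lintegral_mono_ae (g := fun _ => ENNReal.ofReal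
      ((B + 1 + |Real.log (1 - γ n)|) * (π.restrict A).real univ)) ?_) (by simp)
    filter_upwards [hprob] with ω hω
    have := hω n
    have := h.lintegral_enorm_log_step_le π (prEstimate f π₀ γ X n ω) (π.restrict A) (hγ n)
    rw [prEstimate_eq_past] at this
    exact this
  obtain ⟨h1, h2⟩ := integrable_integral_past hXm hXi hXl n hgm hgi
  refine ⟨hgi, ?_⟩
  rw [h2]
  have i1 : Integrable (fun ω => kl f π (prEstimate f π₀ γ X n ω) - π.real Aᶜ * (B + 1)) P :=
    hint.sub (integrable_const _)
  have key : ∫ ω, (γ n * (kl f π (prEstimate f π₀ γ X n ω) - π.real Aᶜ * (B + 1))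
      - γ n ^ 2 / (1 - γ n) * (B + 1)) ∂P
      ≤ ∫ ω, ∫ x, g (past n (fun i => X i ω), x) ∂(dataLaw f π) ∂P := by
    refine integral_mono_ae ((i1.const_mul _).sub (integrable_const _)) h1 ?_
    filter_upwards [hprob] with ω hω
    have := h.isProbabilityMeasure_dataLaw π
    have := hω n
    have h3 := h.le_integral_log_step π (prEstimate f π₀ γ X n ω) hA (hγ n)
    rw [integral_prod _ (h.integrable_log_step π (prEstimate f π₀ γ X n ω) _ (hγ n))] at h3
    refine h3.trans (le_of_eq ?_)
    simp only [hg, prEstimate_eq_past]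
  rw [integral_sub (i1.const_mul _) (integrable_const _), integral_const_mul,
    integral_sub hint (integrable_const _)] at key
  simpa using key

omit hXm hXi hXl [IsProbabilityMeasure π₀] [IsProbabilityMeasure P] mΩ in
-- The sum of the logarithms is log v with v the density of the estimate with respect to π₀. Since
-- log v ≤ v and π ≤ Mπ₀ on A, its integral is at most M times the total mass 1 of the estimate.
theorem sum_integral_log_prFactor_le {A : Set Θ} {M : ℕ}
    (hM : π.restrict A ≤ (M : ℝ≥0∞) • π₀) (n : ℕ) (ω : Ω)
    (hω : ∀ n, IsProbabilityMeasure (prEstimate f π₀ γ X n ω)) :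
    ∑ i ∈ Finset.range n, ∫ u in A, Real.log (prFactor f π₀ γ (fun i => X i ω) i u) ∂π ≤ M := by
  set ρ := π.restrict A with hρ
  set x : ℕ → ℝ := fun i => X i ω with hx
  have hi : ∀ i, Integrable (fun u => Real.log (prFactor f π₀ γ x i u)) ρ := fun i => by
    refine Integrable.mono' (((h.integrable ρ (x i)).div_const
      (marginal f (predictiveRecursion f π₀ γ x i) (x i))).add
      (integrable_const |Real.log (1 - γ i)|))
      (h.measurable_prFactor_right x i).log.aestronglyMeasurable
      (Eventually.of_forall fun u => ?_)
    exact h.abs_log_step_le _ (hγ i) _ _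
  have hpos : ∀ u, 0 < ∏ i ∈ Finset.range n, prFactor f π₀ γ x i u := fun u =>
    Finset.prod_pos fun i _ => h.prFactor_pos hγ x i u
  have hlint : ∫⁻ u, ENNReal.ofReal (∏ i ∈ Finset.range n, prFactor f π₀ γ x i u) ∂ρ ≤ M := by
    have hp : predictiveRecursion f π₀ γ x n univ = 1 := (hω n).measure_univ
    rw [h.predictiveRecursion_eq_withDensity hγ, withDensity_apply _ MeasurableSet.univ,
      Measure.restrict_univ] at hp
    calc ∫⁻ u, ENNReal.ofReal (∏ i ∈ Finset.range n, prFactor f π₀ γ x i u) ∂ρ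
        ≤ ∫⁻ u, ENNReal.ofReal (∏ i ∈ Finset.range n, prFactor f π₀ γ x i u)
          ∂((M : ℝ≥0∞) • π₀) := lintegral_mono' hM le_rfl
      _ = M * ∫⁻ u, ∏ i ∈ Finset.range n, ENNReal.ofReal (prFactor f π₀ γ x i u) ∂π₀ := by
          rw [lintegral_smul_measure, smul_eq_mul]
          congr 1
          refine lintegral_congr fun u => ?_
          rw [ENNReal.ofReal_prod_of_nonneg fun i _ => (h.prFactor_pos hγ x i u).le]
      _ = M := by rw [hp, mul_one]
  have hmeas : Measurable fun u => ∏ i ∈ Finset.range n, prFactor f π₀ γ x i u :=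
    Finset.measurable_prod _ fun i _ => h.measurable_prFactor_right x i
  have hprod : Integrable (fun u => ∏ i ∈ Finset.range n, prFactor f π₀ γ x i u) ρ := by
    refine ⟨hmeas.aestronglyMeasurable, ?_⟩
    rw [hasFiniteIntegral_iff_ofReal (Eventually.of_forall fun u => (hpos u).le)]
    exact hlint.trans_lt (ENNReal.natCast_lt_top M)
  rw [← integral_finsetSum _ fun i _ => hi i]
  calc ∫ u, ∑ i ∈ Finset.range n, Real.log (prFactor f π₀ γ x i u) ∂ρ
      ≤ ∫ u, ∏ i ∈ Finset.range n, prFactor f π₀ γ x i u ∂ρ := by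
        refine integral_mono (integrable_finsetSum _ fun i _ => hi i) hprod fun u => ?_
        simp only
        rw [← Real.log_prod fun i _ => (h.prFactor_pos hγ x i u).ne']
        exact (Real.log_le_sub_one_of_pos (hpos u)).trans (by linarith)
    _ ≤ M := by
        rw [integral_eq_lintegral_of_nonneg_ae (Eventually.of_forall fun u => (hpos u).le)
          hmeas.aestronglyMeasurable]
        exact ENNReal.toReal_le_of_le_ofReal (Nat.cast_nonneg M) (by simpa using hlint)

theorem sum_weights_integral_kl_le (hsq : Summable fun i => γ i ^ 2) (hπ : π ≪ π₀) {δ : ℝ}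
    (hδ : 0 < δ) : ∃ C : ℝ, ∀ n, ∑ i ∈ Finset.range n,
      γ i * ∫ ω, kl f π (prEstimate f π₀ γ X i ω) ∂P ≤ C + δ * ∑ i ∈ Finset.range n, γ i := by
  have hB := h.bound_nonneg
  -- The loss off A is π(Aᶜ)(B + 1) per unit weight, hence at most δ.
  obtain ⟨A, hA, M, hM, hAc⟩ := exists_restrict_le_smul hπ (δ := δ / (B + 1)) (by positivity)
  have hs := (summable_sq_div_one_sub hsq).mul_right (B + 1)
  have hnn : ∀ i, 0 ≤ γ i ^ 2 / (1 - γ i) * (B + 1) := fun i =>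
    mul_nonneg (div_nonneg (sq_nonneg _) (by linarith [(hγ i).2])) (by linarith)
  refine ⟨M + ∑' i, γ i ^ 2 / (1 - γ i) * (B + 1), fun n => ?_⟩
  have hAc' : π.real Aᶜ * (B + 1) ≤ δ := by rwa [le_div_iff₀ (by positivity)] at hAc
  have hstep := integral_kl_le_integral_log_prFactor (π₀ := π₀) h hγ hXm hXi hXl hA
  have h1 : ∑ i ∈ Finset.range n, ∫ ω, ∫ u in A,
      Real.log (prFactor f π₀ γ (fun i => X i ω) i u) ∂π ∂P ≤ M := by
    rw [← integral_finsetSum _ fun i _ => (hstep i).1]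
    calc _ ≤ ∫ _, (M : ℝ) ∂P := by
          refine integral_mono_ae (integrable_finsetSum _ fun i _ => (hstep i).1)
            (integrable_const _) ?_
          filter_upwards [ae_isProbabilityMeasure_prEstimate (π₀ := π₀) h hγ hXm hXi hXl] with ω hω
          exact sum_integral_log_prFactor_le h hγ hM n ω hω
      _ = M := by simp
  have h2 : ∑ i ∈ Finset.range n, (γ i * ∫ ω, kl f π (prEstimate f π₀ γ X i ω) ∂P - δ * γ i
      - γ i ^ 2 / (1 - γ i) * (B + 1)) ≤ (M : ℝ) := by
    refine le_trans (Finset.sum_le_sum fun i _ => ?_) h1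
    refine le_trans ?_ (hstep i).2
    have := mul_le_mul_of_nonneg_left hAc' (hγ i).1.le
    linarith
  rw [Finset.sum_sub_distrib, Finset.sum_sub_distrib, ← Finset.mul_sum] at h2
  have h3 := hs.sum_le_tsum (Finset.range n) fun i _ => hnn i
  linarith

/-- The predictive recursion estimate of the mixture is consistent in Kullback–Leibler
divergence. -/
theorem ae_tendsto_kl_prEstimate (hsum : ¬ Summable γ) (hsq : Summable fun i => γ i ^ 2)
    (hπ : π ≪ π₀) :
    ∀ᵐ ω ∂P, Tendsto (fun n => kl f π (prEstimate f π₀ γ X n ω)) atTop (𝓝 0) := by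
  obtain ⟨g, hg⟩ := exists_ae_tendsto_kl_prEstimate (π₀ := π₀) h hγ hXm hXi hXl hsq
  have hbd := ae_norm_kl_prEstimate_le (π₀ := π₀) h hγ hXm hXi hXl
  have hm : ∀ n, AEStronglyMeasurable (fun ω => kl f π (prEstimate f π₀ γ X n ω)) P := fun n =>
    (h.measurable_kl_prEstimate hγ hXm n).aestronglyMeasurable
  have hlim : Tendsto (fun n => ∫ ω, kl f π (prEstimate f π₀ γ X n ω) ∂P) atTop
      (𝓝 (∫ ω, g ω ∂P)) :=
    tendsto_integral_of_dominated_convergence (fun _ => B) hm (integrable_const B)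
      (fun n => hbd.mono fun ω hω => hω n) hg
  -- The almost sure limit g is nonnegative, so an expectation that is at most 0 makes it vanish
  -- almost surely.
  have hle : ∫ ω, g ω ∂P ≤ 0 := nonpos_of_weighted_sum_le hlim (fun i => (hγ i).1.le) hsum
    fun δ hδ => sum_weights_integral_kl_le h hγ hXm hXi hXl hsq hπ hδ
  have hg0 : 0 ≤ᵐ[P] g := by
    filter_upwards [hg, ae_isProbabilityMeasure_prEstimate (π₀ := π₀) h hγ hXm hXi hXl] with ω h1 h2
    refine ge_of_tendsto' h1 fun n => ?_
    have := h2 n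
    exact h.kl_nonneg _ _
  have hgi : Integrable g P := by
    refine Integrable.of_bound (aestronglyMeasurable_of_tendsto_ae atTop hm hg) B ?_
    filter_upwards [hg, hbd] with ω h1 h2
    exact le_of_tendsto' h1.norm h2
  have hz := (integral_eq_zero_iff_of_nonneg_ae hg0 hgi).1
    (le_antisymm hle (integral_nonneg_of_ae hg0))
  filter_upwards [hg, hz] with ω h1 h2
  rwa [h2] at h1

end Estimate

/-! ### Stability of the objective in the mixture -/

section Objective

variable {Θ : Set ℝ} {f : ℝ → Θ → ℝ} {B : ℝ}

theorem measurableSet_selectionRegion (t : ℝ) : MeasurableSet (selectionRegion t) :=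
  measurableSet_lt measurable_const measurable_id.abs

/-- The selected observations that do not exceed `z`. -/
def selectedIic (t : ℝ) (z : EReal) : Set ℝ := {y : ℝ | (y : EReal) ≤ z} ∩ selectionRegion t

theorem measurableSet_coe_le (z : EReal) : MeasurableSet {y : ℝ | (y : EReal) ≤ z} :=
  measurableSet_le measurable_coe_real_ereal measurable_const

theorem measurableSet_selectedIic (t : ℝ) (z : EReal) : MeasurableSet (selectedIic t z) :=
  (measurableSet_coe_le z).inter (measurableSet_selectionRegion t)

theorem selMarginalCDF_eq (t : ℝ) (μ : Measure Θ) (z : EReal) :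
    selMarginalCDF f t μ z = (∫ y in selectedIic t z, marginal f μ y) / selectionProb f t μ := by
  unfold selMarginalCDF selMarginal
  rw [integral_div, setIntegral_indicator (measurableSet_selectionRegion t)]
  rfl

theorem RatioBounded.integrable_uncurry (h : RatioBounded f B) (μ : Measure Θ)
    [IsFiniteMeasure μ] (s : Set ℝ) :
    Integrable (Function.uncurry fun (θ : Θ) (y : ℝ) => f y θ)
      (μ.prod (volume.restrict s)) := by
  refine ⟨(h.measurable.comp measurable_swap).aestronglyMeasurable, ?_⟩
  rw [hasFiniteIntegral_iff_ofReal (f := Function.uncurry fun (θ : Θ) (y : ℝ) => f y θ)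
      (Eventually.of_forall fun p => h.nonneg p.2 p.1)]
  change ∫⁻ p : Θ × ℝ, ENNReal.ofReal (f p.2 p.1) ∂(μ.prod (volume.restrict s)) < ∞
  rw [lintegral_prod (fun p : Θ × ℝ => ENNReal.ofReal (f p.2 p.1))
      (h.measurable_ofReal.comp measurable_swap).aemeasurable]
  calc ∫⁻ θ, (∫⁻ y in s, ENNReal.ofReal (f y θ)) ∂μ ≤ ∫⁻ _, 1 ∂μ :=
        lintegral_mono fun θ => (setLIntegral_le_lintegral _ _).trans (h.lintegral_eq_one θ).le
    _ < ∞ := by simp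

/-- By Fubini the normalizing constant, too, depends on the prior only through the mixture. -/
theorem RatioBounded.selectionProb_eq (h : RatioBounded f B) (t : ℝ) (μ : Measure Θ)
    [IsFiniteMeasure μ] :
    selectionProb f t μ = ∫ y in selectionRegion t, marginal f μ y :=
  integral_integral_swap (h.integrable_uncurry μ _)

theorem RatioBounded.selectionProb_pos (h : RatioBounded f B) {t : ℝ}
    (hS : ∀ θ, 0 < ∫ y in selectionRegion t, f y θ) (μ : Measure Θ) [IsProbabilityMeasure μ] :
    0 < selectionProb f t μ := by
  unfold selectionProb
  rw [integral_pos_iff_support_of_nonneg (fun θ => (hS θ).le)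
    (h.integrable_uncurry μ _).integral_prod_left]
  have : Function.support (fun θ => ∫ y in selectionRegion t, f y θ) = univ :=
    eq_univ_of_forall fun θ => (hS θ).ne'
  rw [this]; simp

theorem RatioBounded.abs_setIntegral_marginal_sub_le (h : RatioBounded f B) (π μ : Measure Θ)
    [IsFiniteMeasure π] [IsFiniteMeasure μ] (s : Set ℝ) :
    |(∫ y in s, marginal f μ y) - ∫ y in s, marginal f π y|
      ≤ ∫ y, |marginal f μ y - marginal f π y| := by
  have i1 := h.integrable_marginal μ
  have i2 := h.integrable_marginal π
  rw [← integral_sub i1.integrableOn i2.integrableOn]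
  exact (abs_integral_le_integral_abs).trans
    (setIntegral_le_integral (i1.sub i2).abs (Eventually.of_forall fun y => abs_nonneg _))

/-- Written so that the perturbed quantities enter only through a'/b' ≤ 1: no lower bound on the
estimated selection probability b' is needed. -/
theorem abs_div_sub_div_le {a b a' b' d : ℝ} (ha' : 0 ≤ a') (hab' : a' ≤ b') (hb : 0 < b)
    (hb' : 0 < b') (h1 : |a' - a| ≤ d) (h2 : |b' - b| ≤ d) : |a' / b' - a / b| ≤ 2 * d / b := by
  have e : a' / b' - a / b = ((a' - a) - a' / b' * (b' - b)) / b := by field_simp; ring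
  have hr : |a' / b'| ≤ 1 := by
    rw [abs_of_nonneg (div_nonneg ha' hb'.le)]; exact (div_le_one hb').2 hab'
  rw [e, abs_div, abs_of_pos hb]
  gcongr
  calc |(a' - a) - a' / b' * (b' - b)| ≤ |a' - a| + |a' / b'| * |b' - b| := by
        rw [← abs_mul]; exact abs_sub _ _
    _ ≤ d + 1 * d := by gcongr
    _ = 2 * d := by ring

/-- Both the numerator and the denominator of M_S move by at most the L¹ distance whatever the
threshold, so the bound is uniform in w. The 4 is a factor 2 for each of the two values of M_S. -/
theorem RatioBounded.abs_objective_sub_le (h : RatioBounded f B) {t : ℝ}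
    (hS : ∀ θ, 0 < ∫ y in selectionRegion t, f y θ) (π μ : Measure Θ) [IsProbabilityMeasure π]
    [IsProbabilityMeasure μ] (α : ℝ) (θ : Θ) (w : ℝ) :
    |objective f t α μ θ w - objective f t α π θ w|
      ≤ 4 * (∫ y, |marginal f μ y - marginal f π y|) / selectionProb f t π := by
  have key : ∀ z, |selMarginalCDF f t μ z - selMarginalCDF f t π z|
      ≤ 2 * (∫ y, |marginal f μ y - marginal f π y|) / selectionProb f t π := fun z => by
    rw [selMarginalCDF_eq, selMarginalCDF_eq]
    refine abs_div_sub_div_le (integral_nonneg (h.marginal_nonneg μ)) ?_ (h.selectionProb_pos hS π)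
      (h.selectionProb_pos hS μ) (h.abs_setIntegral_marginal_sub_le π μ _) ?_
    · rw [h.selectionProb_eq]
      exact setIntegral_mono_set (h.integrable_marginal μ).integrableOn
        (Eventually.of_forall (h.marginal_nonneg μ)) inter_subset_right.eventuallyLE
    · rw [h.selectionProb_eq, h.selectionProb_eq]
      exact h.abs_setIntegral_marginal_sub_le π μ _
  have e : objective f t α μ θ w - objective f t α π θ w
      = (selMarginalCDF f t μ (truncQuantile f t θ (α * w + 1 - α))
          - selMarginalCDF f t π (truncQuantile f t θ (α * w + 1 - α)))
        - (selMarginalCDF f t μ (truncQuantile f t θ (α * w))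
          - selMarginalCDF f t π (truncQuantile f t θ (α * w))) := by
    simp only [objective]; ring
  rw [e]
  refine (abs_sub _ _).trans ((add_le_add (key _) (key _)).trans (le_of_eq ?_))
  ring

/-- Estimates of the prior whose mixture is close to the true one in Kullback–Leibler divergence
have uniformly close objectives. -/
theorem RatioBounded.exists_kl_lt_imp_objective_close (h : RatioBounded f B) {t : ℝ}
    (hS : ∀ θ, 0 < ∫ y in selectionRegion t, f y θ) (π : Measure Θ) [IsProbabilityMeasure π]
    (α : ℝ) (θ : Θ) {η : ℝ} (hη : 0 < η) :
    ∃ κ : ℝ, 0 < κ ∧ ∀ μ : Measure Θ, IsProbabilityMeasure μ → kl f π μ < κ →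
      ∀ w, |objective f t α μ θ w - objective f t α π θ w| ≤ η := by
  set s := selectionProb f t π with hs
  have hs0 : 0 < s := h.selectionProb_pos hS π
  -- For divergence below 4δ² the Pinsker-type bound is at most 4δ, and 4 · 4δ / s = η.
  set δ := η * s / 16 with hδ
  have hδ0 : 0 < δ := by positivity
  refine ⟨4 * δ ^ 2, by positivity, fun μ hμ hκ w => ?_⟩
  refine (h.abs_objective_sub_le hS π μ α θ w).trans ?_
  rw [← hs, div_le_iff₀ hs0]
  have h1 := h.integral_abs_marginal_sub_le π μ hδ0
  have h2 : kl f π μ / (2 * δ) ≤ 2 * δ := by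
    rw [div_le_iff₀ (by positivity)]; nlinarith
  have h3 : 16 * δ = η * s := by rw [hδ]; ring
  linarith

end Objective

/-! ### Continuity of the oracle objective -/

section Quantile

variable {Θ : Set ℝ} {f : ℝ → Θ → ℝ} {B : ℝ}

/-- The truncated kernel is the case of a Dirac prior, so the results on mixtures apply to it. -/
theorem RatioBounded.truncDensity_eq_selMarginal (h : RatioBounded f B) (t : ℝ) (θ : Θ) :
    truncDensity f t θ = selMarginal f t (Measure.dirac θ) := by
  ext y
  have e : marginal f (Measure.dirac θ) = fun u => f u θ := funext (h.marginal_dirac θ)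
  rw [truncDensity, selMarginal, h.selectionProb_eq, e]

theorem RatioBounded.truncDensity_nonneg (h : RatioBounded f B) (t : ℝ) (θ : Θ) (y : ℝ) :
    0 ≤ truncDensity f t θ y :=
  div_nonneg (indicator_nonneg (fun u _ => h.nonneg u θ) y) (integral_nonneg fun u => h.nonneg u θ)

theorem RatioBounded.integrable_density (h : RatioBounded f B) (θ : Θ) :
    Integrable fun y => f y θ := by
  have := h.integrable_marginal (Measure.dirac θ)
  rwa [funext (h.marginal_dirac θ)] at this

theorem RatioBounded.integrable_truncDensity (h : RatioBounded f B) (t : ℝ) (θ : Θ) :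
    Integrable (truncDensity f t θ) :=
  ((h.integrable_density θ).indicator (measurableSet_selectionRegion t)).div_const _

theorem integral_truncDensity {t : ℝ} {θ : Θ} (hS : 0 < ∫ y in selectionRegion t, f y θ) :
    ∫ y, truncDensity f t θ y = 1 := by
  unfold truncDensity
  rw [integral_div, integral_indicator (measurableSet_selectionRegion t), div_self hS.ne']

theorem RatioBounded.continuous_truncCDF (h : RatioBounded f B) (t : ℝ) (θ : Θ) :
    Continuous (truncCDF f t θ) := by
  have hi := h.integrable_truncDensity t θ
  have e : truncCDF f t θ = fun y => truncCDF f t θ 0 + ∫ u in (0 : ℝ)..y, truncDensity f t θ u := by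
    ext y
    have := intervalIntegral.integral_Iic_sub_Iic (a := (0 : ℝ)) (b := y) hi.integrableOn
      hi.integrableOn
    simp only [truncCDF]
    linarith
  rw [e]
  exact continuous_const.add
    (intervalIntegral.continuous_primitive (fun a b => hi.intervalIntegrable) 0)

theorem RatioBounded.tendsto_truncCDF_atTop (h : RatioBounded f B) {t : ℝ} {θ : Θ}
    (hS : 0 < ∫ y in selectionRegion t, f y θ) : Tendsto (truncCDF f t θ) atTop (𝓝 1) := by
  rw [← integral_truncDensity hS]
  exact (aecover_Iic tendsto_id).integral_tendsto_of_countably_generated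
    (h.integrable_truncDensity t θ)

theorem RatioBounded.tendsto_truncCDF_atBot (h : RatioBounded f B) {t : ℝ} {θ : Θ} :
    Tendsto (truncCDF f t θ) atBot (𝓝 0) := by
  have hi := h.integrable_truncDensity t θ
  have h1 : Tendsto (fun y => ∫ u in Ioi y, truncDensity f t θ u) atBot
      (𝓝 (∫ u, truncDensity f t θ u)) :=
    (aecover_Ioi tendsto_id).integral_tendsto_of_countably_generated hi
  have h2 := (tendsto_const_nhds (x := ∫ u, truncDensity f t θ u)).sub h1
  rw [sub_self] at h2
  refine h2.congr fun y => ?_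
  rw [sub_eq_iff_eq_add, truncCDF, intervalIntegral.integral_Iic_add_Ioi hi.integrableOn
    hi.integrableOn]

theorem truncQuantile_mono (t : ℝ) (θ : Θ) : Monotone (truncQuantile f t θ) := fun _ _ hpq =>
  sInf_le_sInf (image_mono fun _ hy => hpq.trans hy)

/-- The distribution function takes the value `p` at its `p`-quantile. -/
theorem RatioBounded.setIntegral_truncDensity_truncQuantile (h : RatioBounded f B) {t : ℝ} {θ : Θ}
    (hS : 0 < ∫ y in selectionRegion t, f y θ) {p : ℝ} (hp : p ∈ Icc (0 : ℝ) 1) :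
    ∫ y in {y : ℝ | (y : EReal) ≤ truncQuantile f t θ p}, truncDensity f t θ y = p := by
  have hcont := h.continuous_truncCDF t θ
  -- The quantile is -∞ for p = 0 and +∞ when p = 1 is not attained. Otherwise it is a real number,
  -- at which continuity of F_S gives both inequalities.
  rcases hp.1.eq_or_lt with h0 | h0
  · have hA : {y : ℝ | p ≤ truncCDF f t θ y} = univ := eq_univ_of_forall fun y => by
      rw [mem_ofPred_eq, ← h0]; exact integral_nonneg (h.truncDensity_nonneg t θ)
    have hq : truncQuantile f t θ p = ⊥ := by
      rw [truncQuantile, hA, image_univ, sInf_eq_bot]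
      intro b hb
      obtain ⟨x, -, hx⟩ := EReal.lt_iff_exists_real_btwn.1 hb
      exact ⟨x, mem_range_self x, hx⟩
    rw [hq]
    simp [← h0]
  set A : Set ℝ := {y : ℝ | p ≤ truncCDF f t θ y} with hA
  rcases A.eq_empty_or_nonempty with he | hne
  · have hq : truncQuantile f t θ p = ⊤ := by
      rw [truncQuantile, ← hA, he, image_empty, sInf_empty]
    have hp1 : p = 1 := by
      refine le_antisymm hp.2 (le_of_not_gt fun hlt => ?_)
      obtain ⟨y, hy⟩ := ((h.tendsto_truncCDF_atTop hS).eventually_const_lt hlt).exists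
      exact (he ▸ (show y ∈ A from hy.le) : y ∈ (∅ : Set ℝ))
    rw [hq, hp1]
    simpa using integral_truncDensity hS
  · have hmono : Monotone (truncCDF f t θ) := fun a b hab =>
      setIntegral_mono_set (h.integrable_truncDensity t θ).integrableOn
        (Eventually.of_forall (h.truncDensity_nonneg t θ)) (Iic_subset_Iic.2 hab).eventuallyLE
    have hbdd : BddBelow A := by
      obtain ⟨y, hy⟩ := ((h.tendsto_truncCDF_atBot (t := t) (θ := θ)).eventually_lt_const h0).exists
      exact ⟨y, fun a ha => le_of_not_gt fun hlt => absurd (hmono hlt.le) (hy.trans_le ha).not_ge⟩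
    have hclosed : IsClosed A := isClosed_le continuous_const hcont
    have hleast : IsLeast A (sInf A) := hclosed.isLeast_csInf hne hbdd
    set a := sInf A with ha
    have hle : truncCDF f t θ a ≤ p := by
      refine le_of_tendsto (hcont.tendsto a |>.mono_left (nhdsWithin_le_nhds (s := Iio a))) ?_
      filter_upwards [self_mem_nhdsWithin] with y hy
      exact le_of_not_ge fun hpy => absurd (hleast.2 hpy) (not_le.2 hy)
    have hq : truncQuantile f t θ p = (a : EReal) := by
      refine IsLeast.csInf_eq ⟨mem_image_of_mem _ hleast.1, ?_⟩
      rintro _ ⟨y, hy, rfl⟩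
      exact EReal.coe_le_coe_iff.2 (hleast.2 hy)
    have hset : {y : ℝ | (y : EReal) ≤ truncQuantile f t θ p} = Iic a := by
      ext y; rw [hq]; simp
    rw [hset]
    exact le_antisymm hle hleast.1

/-- A quantitative absolute continuity: with r the ratio of the two mixtures, r ≤ r²/L + L, and r²
has mean at most B under the law of the mixture for μ. -/
theorem RatioBounded.setIntegral_marginal_le (h : RatioBounded f B) (π μ : Measure Θ)
    [IsProbabilityMeasure π] [IsProbabilityMeasure μ] {E : Set ℝ} (hE : MeasurableSet E) {L : ℝ}
    (hL : 0 < L) : ∫ y in E, marginal f π y ≤ B / L + L * ∫ y in E, marginal f μ y := by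
  have := h.isProbabilityMeasure_dataLaw μ
  have hmm := (h.measurable_marginal μ).ennreal_ofReal
  have e1 : ∫ y in E, marginal f π y
      = ∫ y in E, marginal f π y / marginal f μ y ∂(dataLaw f μ) := by
    rw [dataLaw, setIntegral_withDensity_eq_setIntegral_toReal_smul hmm (by simp) _ hE]
    refine integral_congr_ae (ae_restrict_of_ae ?_)
    filter_upwards [h.ae_pos_imp_pos π μ] with y hy
    rw [ENNReal.toReal_ofReal (h.marginal_nonneg _ _), smul_eq_mul]
    rcases (h.marginal_nonneg π y).eq_or_lt with h0 | h0
    · simp [← h0]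
    · rw [mul_div_cancel₀ _ (hy h0).ne']
  have e2 : ∫ y in E, marginal f μ y = (dataLaw f μ).real E := by
    have : (dataLaw f μ).real E = ∫ _ in E, (1 : ℝ) ∂(dataLaw f μ) := by simp
    rw [this, dataLaw, setIntegral_withDensity_eq_setIntegral_toReal_smul hmm (by simp) _ hE]
    refine integral_congr_ae (Eventually.of_forall fun y => ?_)
    simp [ENNReal.toReal_ofReal (h.marginal_nonneg μ y)]
  have i1 := h.integrable_sq_ratio μ π μ
  have i2 := h.integrable_ratio μ π μ
  rw [e1, e2]
  calc ∫ y in E, marginal f π y / marginal f μ y ∂(dataLaw f μ)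
      ≤ ∫ y in E, ((marginal f π y / marginal f μ y) ^ 2 / L + L) ∂(dataLaw f μ) := by
        refine integral_mono i2.integrableOn
          ((i1.div_const L).add (integrable_const L)).integrableOn fun y => ?_
        simp only
        rw [div_add' _ _ _ hL.ne', le_div_iff₀ hL]
        nlinarith [sq_nonneg (marginal f π y / marginal f μ y - L), h.ratio_nonneg π μ y]
    _ = (∫ y in E, (marginal f π y / marginal f μ y) ^ 2 ∂(dataLaw f μ)) / L
          + L * (dataLaw f μ).real E := by
        rw [integral_add (i1.div_const L).integrableOn (integrable_const L), integral_div]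
        simp [mul_comm]
    _ ≤ B / L + L * (dataLaw f μ).real E := by
        gcongr
        exact (setIntegral_le_integral i1 (Eventually.of_forall fun y => sq_nonneg _)).trans
          (h.integral_sq_ratio_le μ π μ)

/-- The selected set between two quantiles has mass exactly q - p under the truncated kernel, even
if the quantile function jumps in between. Untruncated, its mass is no larger, and absolute
continuity transfers the bound to the mixture. -/
theorem RatioBounded.abs_selMarginalCDF_truncQuantile_sub_le (h : RatioBounded f B) {t : ℝ}
    (hS : ∀ θ, 0 < ∫ y in selectionRegion t, f y θ) (π : Measure Θ) [IsProbabilityMeasure π]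
    (θ : Θ) {p q : ℝ} (hp : p ∈ Icc (0 : ℝ) 1) (hq : q ∈ Icc (0 : ℝ) 1) {L : ℝ} (hL : 0 < L) :
    |selMarginalCDF f t π (truncQuantile f t θ q) - selMarginalCDF f t π (truncQuantile f t θ p)|
      ≤ (B / L + L * |q - p|) / selectionProb f t π := by
  wlog hpq : p ≤ q generalizing p q
  · rw [abs_sub_comm, abs_sub_comm q p]
    exact this hq hp (le_of_not_ge hpq)
  set δ := Measure.dirac θ with hδ
  have hs : 0 < selectionProb f t π := h.selectionProb_pos hS π
  have hsθ : 0 < selectionProb f t δ := h.selectionProb_pos hS δ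
  have hsub : selectedIic t (truncQuantile f t θ p) ⊆ selectedIic t (truncQuantile f t θ q) :=
    inter_subset_inter_left _ fun y hy => le_trans hy (truncQuantile_mono t θ hpq)
  set E := selectedIic t (truncQuantile f t θ q) \ selectedIic t (truncQuantile f t θ p) with hE
  have hEm : MeasurableSet E :=
    (measurableSet_selectedIic t _).diff (measurableSet_selectedIic t _)
  have hdiff : ∀ (μ : Measure Θ) [IsProbabilityMeasure μ],
      selMarginalCDF f t μ (truncQuantile f t θ q) - selMarginalCDF f t μ (truncQuantile f t θ p)
        = (∫ y in E, marginal f μ y) / selectionProb f t μ := fun μ _ => by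
    rw [selMarginalCDF_eq, selMarginalCDF_eq, hE, setIntegral_sdiff (measurableSet_selectedIic t _)
      (h.integrable_marginal μ).integrableOn hsub, sub_div]
  have hquant : ∀ {r : ℝ}, r ∈ Icc (0 : ℝ) 1 → selMarginalCDF f t δ (truncQuantile f t θ r) = r :=
    fun hr => by
      rw [selMarginalCDF, ← h.truncDensity_eq_selMarginal]
      exact h.setIntegral_truncDensity_truncQuantile (hS θ) hr
  have h1 := hdiff δ
  rw [hquant hp, hquant hq, eq_div_iff hsθ.ne'] at h1
  have hsθ1 : selectionProb f t δ ≤ 1 := by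
    rw [h.selectionProb_eq]
    refine (setIntegral_le_integral (h.integrable_marginal δ)
      (Eventually.of_forall (h.marginal_nonneg δ))).trans ?_
    rw [integral_eq_lintegral_of_nonneg_ae (Eventually.of_forall (h.marginal_nonneg δ))
      (h.measurable_marginal δ).aestronglyMeasurable, h.lintegral_marginal]
    simp
  have h2 := h.setIntegral_marginal_le π δ hEm hL
  rw [hdiff π, abs_of_nonneg (div_nonneg (integral_nonneg (h.marginal_nonneg π)) hs.le),
    abs_of_nonneg (sub_nonneg.2 hpq)]
  gcongr
  refine h2.trans ?_
  rw [← h1]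
  gcongr
  exact mul_le_of_le_one_right (sub_nonneg.2 hpq) hsθ1

theorem RatioBounded.continuousOn_selMarginalCDF_truncQuantile (h : RatioBounded f B) {t : ℝ}
    (hS : ∀ θ, 0 < ∫ y in selectionRegion t, f y θ) (π : Measure Θ) [IsProbabilityMeasure π]
    (θ : Θ) :
    ContinuousOn (fun p => selMarginalCDF f t π (truncQuantile f t θ p)) (Icc 0 1) := by
  have hs : 0 < selectionProb f t π := h.selectionProb_pos hS π
  have hB := h.bound_nonneg
  rw [Metric.continuousOn_iff]
  intro p hp ε hε
  -- L brings B/L below half of ε times the selection probability, and the radius does the same for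
  -- L|q - p|; B + 1 in place of B keeps L positive.
  set L := 2 * (B + 1) / (ε * selectionProb f t π) with hL
  have hL0 : 0 < L := by positivity
  refine ⟨ε * selectionProb f t π / (2 * L), by positivity, fun q hq hqp => ?_⟩
  rw [Real.dist_eq] at hqp ⊢
  refine (h.abs_selMarginalCDF_truncQuantile_sub_le hS π θ hp hq hL0).trans_lt ?_
  rw [div_lt_iff₀ hs]
  have h1 : B / L < ε * selectionProb f t π / 2 := by
    rw [div_lt_iff₀ hL0, hL]
    field_simp
    linarith
  have h2 : L * |q - p| < ε * selectionProb f t π / 2 := by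
    rw [lt_div_iff₀ (by positivity)] at hqp
    linarith
  linarith

theorem RatioBounded.continuousOn_objective (h : RatioBounded f B) {t α : ℝ}
    (hα : α ∈ Ioo (0 : ℝ) 1) (hS : ∀ θ, 0 < ∫ y in selectionRegion t, f y θ) (π : Measure Θ)
    [IsProbabilityMeasure π] (θ : Θ) : ContinuousOn (objective f t α π θ) (Icc 0 1) := by
  have hG := h.continuousOn_selMarginalCDF_truncQuantile hS π θ
  obtain ⟨h0, h1⟩ := hα
  refine (hG.comp (f := fun w => α * w + 1 - α) (by fun_prop) fun w hw => ?_).sub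
    (hG.comp (f := fun w => α * w) (by fun_prop) fun w hw => ?_)
  · obtain ⟨w0, w1⟩ := hw
    constructor <;> nlinarith
  · obtain ⟨w0, w1⟩ := hw
    constructor <;> nlinarith

end Quantile

/-! ### Stability of minimizers under uniform perturbation -/

section Minimizers

theorem exists_mem_minimizers {H : ℝ → ℝ} (hH : ContinuousOn H (Icc 0 1)) :
    ∃ w, w ∈ minimizers H := by
  obtain ⟨w, hw, hmin⟩ := isCompact_Icc.exists_isMinOn (nonempty_Icc.2 zero_le_one) hH
  exact ⟨w, hw, fun v hv => hmin hv⟩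

theorem le_add_of_mem_minimizers {H g : ℝ → ℝ} {η w v : ℝ}
    (hg : ∀ u ∈ Icc (0 : ℝ) 1, |g u - H u| ≤ η) (hw : w ∈ minimizers g)
    (hv : v ∈ Icc (0 : ℝ) 1) : H w ≤ H v + 2 * η := by
  have h1 := abs_le.1 (hg w hw.1)
  have h2 := abs_le.1 (hg v hv)
  have h3 := hw.2 v hv
  linarith [h1.1, h2.2]

/-- Minimizers of uniformly close functions are close to the minimizers of a continuous function. -/
theorem exists_close_imp_iSup_infEDist_lt {H : ℝ → ℝ} (hH : ContinuousOn H (Icc 0 1)) {ε : ℝ}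
    (hε : 0 < ε) : ∃ η : ℝ, 0 < η ∧ ∀ g : ℝ → ℝ, (∀ w ∈ Icc (0 : ℝ) 1, |g w - H w| ≤ η) →
      ⨆ w ∈ minimizers g, Metric.infEDist w (minimizers H) < ENNReal.ofReal ε := by
  obtain ⟨v, hv⟩ := exists_mem_minimizers hH
  -- On this compact set H stays above its minimum by a fixed gap. The radius ε/2 leaves room for
  -- the supremum to be strictly below ε.
  set C : Set ℝ := Icc 0 1 ∩ {w | ENNReal.ofReal (ε / 2) ≤ Metric.infEDist w (minimizers H)} with hC
  have hCc : IsCompact C :=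
    isCompact_Icc.inter_right (isClosed_le continuous_const Metric.continuous_infEDist)
  have hfin : ∀ {g : ℝ → ℝ}, (∀ w ∈ minimizers g, w ∉ C) →
      ⨆ w ∈ minimizers g, Metric.infEDist w (minimizers H) < ENNReal.ofReal ε := fun {g} hg => by
    refine lt_of_le_of_lt (iSup₂_le (a := ENNReal.ofReal (ε / 2)) fun w hw => ?_)
      ((ENNReal.ofReal_lt_ofReal_iff hε).2 (by linarith))
    exact le_of_not_ge fun hle => hg w hw ⟨hw.1, hle⟩
  rcases C.eq_empty_or_nonempty with he | hne
  · exact ⟨1, one_pos, fun g _ => hfin fun w _ => by simp [he]⟩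
  obtain ⟨u, hu, hmin⟩ := hCc.exists_isMinOn hne (hH.mono inter_subset_left)
  have hlt : H v < H u := by
    refine lt_of_le_of_ne (hv.2 u hu.1) fun heq => ?_
    have humin : u ∈ minimizers H := ⟨hu.1, fun x hx => heq ▸ hv.2 x hx⟩
    have h0 := hu.2
    rw [mem_ofPred_eq, Metric.infEDist_zero_of_mem humin] at h0
    have : 0 < ENNReal.ofReal (ε / 2) := by simpa using hε
    exact absurd h0 (not_le.2 this)
  -- A minimizer of g exceeds the minimum of H by at most 2η, which is less than the gap when η is a
  -- third of it.
  refine ⟨(H u - H v) / 3, by linarith, fun g hg => hfin fun w hw hwC => ?_⟩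
  have h1 := le_add_of_mem_minimizers hg hw hv.1
  have h2 : H u ≤ H w := hmin hwC
  linarith

end Minimizers

end SaFAB

/-! ### The theorem -/

theorem theorem1 {Θ : Set ℝ} (f : ℝ → Θ → ℝ) (hf : SaFAB.IsSamplingModel f)
    (t : ℝ) (ht : 0 < t) (α : ℝ) (hα : α ∈ Ioo (0 : ℝ) 1)
    (hS : ∀ θ, 0 < ∫ y in SaFAB.selectionRegion t, f y θ)
    (γ : ℕ → ℝ) (hPR : SaFAB.PRConditions f γ)
    (π π₀ : Measure Θ) [IsProbabilityMeasure π] [IsProbabilityMeasure π₀] (hπ : π ≪ π₀)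
    {Ω : Type*} [MeasurableSpace Ω] (P : Measure Ω) [IsProbabilityMeasure P]
    (y : ℕ → Ω → ℝ) (hy_meas : ∀ i, Measurable (y i)) (hy_indep : iIndepFun y P)
    (hy_law : ∀ i, P.map (y i) =
      volume.withDensity fun u => ENNReal.ofReal (SaFAB.marginal f π u))
    (σ : ℕ → ℕ) (hσ : Function.Injective σ) (k : ℕ → ℕ) (hk : Tendsto k atTop atTop)
    (πhat : ℕ → Ω → Measure Θ)
    (hπhat : ∀ n ω, πhat n ω =
      SaFAB.predictiveRecursion f π₀ γ (fun i => y (σ i) ω) (k n))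
    (θ : Θ) (H : ℝ → ℝ) (hH : H = SaFAB.objective f t α π θ)
    (Hhat : ℕ → Ω → ℝ → ℝ)
    (hHhat : ∀ n ω, Hhat n ω = SaFAB.objective f t α (πhat n ω) θ) :
    (∀ ε : ℝ, 0 < ε →
      Tendsto (fun n => P {ω | ENNReal.ofReal ε ≤
        ⨆ what ∈ SaFAB.minimizers (Hhat n ω), Metric.infEDist what (SaFAB.minimizers H)})
        atTop (𝓝 0)) ∧
    (∀ᵐ ω ∂P, ∀ what : ℕ → ℝ, (∀ n, what n ∈ SaFAB.minimizers (Hhat n ω)) →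
      ∃ wstar ∈ SaFAB.minimizers H, Tendsto (fun n => H (what n)) atTop (𝓝 (H wstar))) := by
  obtain ⟨B, h⟩ := hf.exists_ratioBounded hPR
  have hγ := hPR.weights_mem
  set X : ℕ → Ω → ℝ := fun i => y (σ i) with hX
  have hXm : ∀ i, Measurable (X i) := fun i => hy_meas _
  have hXi : iIndepFun X P := hy_indep.precomp hσ
  have hXl : ∀ i, P.map (X i) = SaFAB.dataLaw f π := fun i => hy_law _
  have hest : ∀ n ω, πhat n ω = SaFAB.prEstimate f π₀ γ X (k n) ω := hπhat
  have hprob := SaFAB.ae_isProbabilityMeasure_prEstimate (π₀ := π₀) h hγ hXm hXi hXl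
  have hkl : ∀ᵐ ω ∂P, Tendsto (fun n => SaFAB.kl f π (πhat n ω)) atTop (𝓝 0) := by
    filter_upwards [SaFAB.ae_tendsto_kl_prEstimate h hγ hXm hXi hXl hPR.weights_sum
      hPR.weights_sq hπ] with ω hω
    simp_rw [hest]
    exact hω.comp hk
  have hcont : ContinuousOn H (Icc 0 1) := hH ▸ h.continuousOn_objective hα hS π θ
  constructor
  · intro ε hε
    obtain ⟨η, hη, hclose⟩ := SaFAB.exists_close_imp_iSup_infEDist_lt hcont hε
    obtain ⟨κ, hκ, hobj⟩ := h.exists_kl_lt_imp_objective_close hS π α θ hη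
    have hmeas : ∀ n, AEStronglyMeasurable (fun ω => SaFAB.kl f π (πhat n ω)) P := fun n => by
      simp_rw [hest]
      exact (h.measurable_kl_prEstimate hγ hXm (k n)).aestronglyMeasurable
    have hin := tendstoInMeasure_iff_norm.1 (tendstoInMeasure_of_tendsto_ae hmeas hkl) κ hκ
    -- Almost surely the bad event forces a divergence of at least κ. Only monotonicity of P as an
    -- outer measure is used, so the bad event need not be measurable.
    refine tendsto_of_tendsto_of_tendsto_of_le_of_le tendsto_const_nhds hin
      (fun n => zero_le) fun n => measure_mono_ae ?_
    filter_upwards [hprob] with ω hω hbad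
    by_contra hlt
    have hp : IsProbabilityMeasure (πhat n ω) := hest n ω ▸ hω (k n)
    have hlt' : SaFAB.kl f π (πhat n ω) < κ := by
      have := not_le.1 hlt
      rw [sub_zero] at this
      exact (Real.le_norm_self _).trans_lt this
    refine absurd (hclose (Hhat n ω) fun w _ => ?_) (not_lt.2 hbad)
    rw [hHhat, hH]
    exact hobj _ hp hlt' w
  -- Any minimizer will do, as H takes the same value at all of them; and H(ŵ_n) is never below it,
  -- so only an upper bound is needed.
  · obtain ⟨wstar, hw⟩ := SaFAB.exists_mem_minimizers hcont
    filter_upwards [hprob, hkl] with ω hω hlim what hwhat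
    refine ⟨wstar, hw, ?_⟩
    rw [Metric.tendsto_atTop']
    intro ε hε
    obtain ⟨κ, hκ, hobj⟩ := h.exists_kl_lt_imp_objective_close hS π α θ
      (show 0 < ε / 3 by linarith)
    obtain ⟨N, hN⟩ := eventually_atTop.1 (hlim.eventually_lt_const hκ)
    refine ⟨N, fun n hn => ?_⟩
    have hp : IsProbabilityMeasure (πhat n ω) := hest n ω ▸ hω (k n)
    have h1 : H (what n) ≤ H wstar + 2 * (ε / 3) :=
      SaFAB.le_add_of_mem_minimizers (g := Hhat n ω)
        (fun u _ => by rw [hHhat, hH]; exact hobj _ hp (hN n hn.le) u) (hwhat n) hw.1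
    have h2 := hw.2 (what n) (hwhat n).1
    rw [Real.dist_eq, abs_of_nonneg (by linarith)]
    linarith
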